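/- **Additivity of the bulk index.** Let $N\in\mathbb N$, $\mathcal H_{\mathrm B}=\ell^2(\mathbb Z^2)\otimes\mathbb C^N$ and $T>0$. For an operator $K$ on $\mathcal H_{\mathrm B}$ let $K_{\mathbf m,\mathbf n}=\langle \mathbf m|K|\mathbf n\rangle$ be its ($N\times N$ matrix-valued) kernel, $|K_{\mathbf m,\mathbf n}|$ the operator norm of this matrix, and $|\mathbf m-\mathbf n|=|m_1-n_1|+|m_2-n_2|$. A *bulk Hamiltonian* of period $T$ is a family $(H(t))_{t\in\mathbb R}$ of bounded self-adjoint operators on $\mathcal H_{\mathrm B}$ such that (i) $H(t+T)=H(t)$ for all $t$; (ii) there are $\mu,C>0$ with $|H(t)_{\mathbf m,\mathbf n}|\le C e^{-\mu|\mathbf m-\mathbf n|}$ for all $t\in[0,T]$ and $\mathbf m,\mathbf n\in\mathbb Z^2$; (iii) $t\mapsto H(t)$ is strongly continuous except for jump discontinuities (finitely many in every bounded interval, with left and right strong limits). Its *propagator* is the strongly continuous family of unitary operators $U(t,s)$ with $U(t,t)=I$, $U(t,r)U(r,s)=U(t,s)$ and $\mathrm i\,\partial_t U(t,s)\psi=H(t)U(t,s)\psi$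 for all $\psi\in\mathcal H_{\mathrm B}$ and all $t$ at which $H$ is strongly continuous; write $U(t)=U(t,0)$. A *switch function* is a function $\Lambda:\mathbb Z\to\mathbb R$ with $\Lambda(n)=1$ for $n$ large and positive and $\Lambda(n)=0$ for $n$ large and negative; in direction $i\in\{1,2\}$ it acts on $\mathcal H_{\mathrm B}$ as multiplication by $\Lambda_i(\mathbf n)=\Lambda(n_i)$. For a family $W(t)$, $0\le t\le T$, of unitary operators, the *bulk index* is $$\mathcal I_{\mathrm B}[W]=\frac12\int_0^T \mathrm{Tr}_{\mathcal H_{\mathrm B}}\Big(W^*\,\partial_tW\,\big[W^*[\Lambda_1,W],\,W^*[\Lambda_2,W]\big]\Big)\,dt ,$$ where $\partial_t$ is the strong derivative. It is called well-defined if, for all switch functions $\Lambda_1,\Lambda_2$ in directions $1,2$, the strong derivative exists and the operator under the trace is trace class for almost every $t\in[0,T]$, the trace is integrable over $[0,T]$, and the value does not depend on the choice of $\Lambda_1,\Lambda_2$. Let $U$ and $V$ be the propagators of two bulk Hamiltonians of the same period $T$, and suppose that $U(T)=V(T)=I$. Then the bulk indices of $U$, of $V$ and of the pointwise product $UV(t)=U(t)V(t)$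 are well-defined, and $$\mathcal I_{\mathrm B}[UV]=\mathcal I_{\mathrm B}[U]+\mathcal I_{\mathrm B}[V].$$ -/

import Mathlib

open Filter Topology Set MeasureTheory
open scoped ENNReal

namespace BulkIndex

noncomputable section

/-! ### The bulk Hilbert space and its operators -/

/-- The bulk Hilbert space `ℓ²(ℤ²) ⊗ ℂ^N`, as square-summable functions `ℤ² → ℂ^N`. -/
abbrev HB (N : ℕ) : Type := lp (fun _ : ℤ × ℤ => EuclideanSpace ℂ (Fin N)) 2

/-- Bounded operators on the bulk Hilbert space. -/
abbrev Op (N : ℕ) : Type := HB N →L[ℂ] HB N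

/-- The matrix kernel `K_{m,n} = ⟨m| K |n⟩`, an operator on `ℂ^N`. Its norm is the operator norm
with respect to the Euclidean norm of `ℂ^N`. -/
def kernel {N : ℕ} (K : Op N) (m n : ℤ × ℤ) :
    EuclideanSpace ℂ (Fin N) →L[ℂ] EuclideanSpace ℂ (Fin N) :=
  (lp.evalCLM ℂ (fun _ : ℤ × ℤ => EuclideanSpace ℂ (Fin N)) 2 m).comp
    (K.comp (lp.singleContinuousLinearMap ℂ (fun _ : ℤ × ℤ => EuclideanSpace ℂ (Fin N)) 2 n))

/-- The distance `|m - n| = |m₁ - n₁| + |m₂ - n₂|` on `ℤ²`. -/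
def latticeDist (m n : ℤ × ℤ) : ℝ := |(m.1 : ℝ) - n.1| + |(m.2 : ℝ) - n.2|

/-! ### Bulk Hamiltonians and propagators -/

/-- Strong continuity of an operator-valued function at one time. -/
def StronglyContinuousAt {E : Type*} [NormedAddCommGroup E] [NormedSpace ℂ E]
    (H : ℝ → (E →L[ℂ] E)) (t : ℝ) : Prop :=
  ∀ ψ : E, ContinuousAt (fun s => H s ψ) t

/-- Strong continuity except for jump discontinuities (finitely many in each bounded interval),
at which the left and right strong limits exist. -/
def PiecewiseStronglyContinuous {E : Type*} [NormedAddCommGroup E] [NormedSpace ℂ E]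
    (H : ℝ → (E →L[ℂ] E)) : Prop :=
  ∃ D : Set ℝ, (∀ a b : ℝ, (D ∩ Icc a b).Finite) ∧
    (∀ t, t ∉ D → StronglyContinuousAt H t) ∧
    ∀ t ∈ D, ∀ ψ : E, (∃ φ, Tendsto (fun s => H s ψ) (𝓝[<] t) (𝓝 φ)) ∧
      ∃ φ, Tendsto (fun s => H s ψ) (𝓝[>] t) (𝓝 φ)

/-- Bulk Hamiltonians of period `T`: self-adjoint, time-periodic, local, and piecewise strongly
continuous. -/
structure IsBulkHamiltonian {N : ℕ} (T : ℝ) (H : ℝ → Op N) : Prop where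
  selfAdjoint : ∀ t, IsSelfAdjoint (H t)
  periodic : ∀ t, H (t + T) = H t
  isLocal : ∃ μ C : ℝ, 0 < μ ∧ 0 < C ∧ ∀ t ∈ Icc 0 T, ∀ m n : ℤ × ℤ,
    ‖kernel (H t) m n‖ ≤ C * Real.exp (-μ * latticeDist m n)
  piecewise : PiecewiseStronglyContinuous H

/-- `U(t,s)` is the unitary propagator generated by `H`: a strongly continuous family of unitary
operators with the evolution property that solves the Schrödinger equation
`i ∂ₜ U(t,s)ψ = H(t) U(t,s)ψ`, where the equation is required at every time `t` at which `H` is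
strongly continuous. -/
structure IsPropagator {E : Type*} [NormedAddCommGroup E] [InnerProductSpace ℂ E]
    [CompleteSpace E] (H : ℝ → (E →L[ℂ] E)) (U : ℝ → ℝ → (E →L[ℂ] E)) : Prop where
  mem_unitary : ∀ t s, U t s ∈ unitary (E →L[ℂ] E)
  refl : ∀ t, U t t = 1
  trans : ∀ t r s, U t r * U r s = U t s
  continuous : ∀ ψ : E, Continuous (fun p : ℝ × ℝ => U p.1 p.2 ψ)
  schrodinger : ∀ t s, StronglyContinuousAt H t → ∀ ψ : E,
    HasDerivAt (fun τ => U τ s ψ) (-Complex.I • H t (U t s ψ)) t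

/-- `A` is the strong derivative at `t` of the operator-valued function `W`. -/
def HasStrongDerivAt {E : Type*} [NormedAddCommGroup E] [NormedSpace ℂ E]
    (W : ℝ → (E →L[ℂ] E)) (A : E →L[ℂ] E) (t : ℝ) : Prop :=
  ∀ ψ : E, HasDerivAt (fun s => W s ψ) (A ψ) t

open Classical in
/-- The strong derivative `∂ₜ W`; the value is `0` where it does not exist as a bounded operator. -/
def strongDeriv {E : Type*} [NormedAddCommGroup E] [NormedSpace ℂ E]
    (W : ℝ → (E →L[ℂ] E)) (t : ℝ) : E →L[ℂ] E :=
  if h : ∃ A, HasStrongDerivAt W A t then h.choose else 0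

theorem HasStrongDerivAt.strongDeriv_eq {E : Type*} [NormedAddCommGroup E] [NormedSpace ℂ E]
    {W : ℝ → (E →L[ℂ] E)} {A : E →L[ℂ] E} {t : ℝ} (h : HasStrongDerivAt W A t) :
    strongDeriv W t = A := by
  have h' : ∃ A, HasStrongDerivAt W A t := ⟨A, h⟩
  rw [strongDeriv, dif_pos h']
  ext1 ψ
  exact (h'.choose_spec ψ).unique (h ψ)

/-! ### Switch functions -/

/-- A switch function `Λ : ℤ → ℝ`: equal to `1` for `n` large and positive, and to `0` for `n` large
and negative. -/
structure SwitchFunction where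
  toFun : ℤ → ℝ
  eventually_one : ∀ᶠ n in atTop, toFun n = 1
  eventually_zero : ∀ᶠ n in atBot, toFun n = 0

theorem SwitchFunction.exists_bound (Λ : SwitchFunction) :
    ∃ C : ℝ, 0 ≤ C ∧ ∀ n, |Λ.toFun n| ≤ C := by
  obtain ⟨b, hb⟩ := eventually_atTop.1 Λ.eventually_one
  obtain ⟨a, ha⟩ := eventually_atBot.1 Λ.eventually_zero
  refine ⟨1 + ∑ k ∈ Finset.Icc a b, |Λ.toFun k|, by positivity, fun n => ?_⟩
  have h0 : 0 ≤ ∑ k ∈ Finset.Icc a b, |Λ.toFun k| := by positivity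
  rcases le_total n a with h | h
  · rw [ha n h, abs_zero]; positivity
  rcases le_total b n with h' | h'
  · rw [hb n h', abs_one]; linarith
  · have h1 : |Λ.toFun n| ≤ ∑ k ∈ Finset.Icc a b, |Λ.toFun k| :=
      Finset.single_le_sum (f := fun k => |Λ.toFun k|) (fun k _ => abs_nonneg _)
        (Finset.mem_Icc.2 ⟨h, h'⟩)
    linarith

/-- The multiplication operator `(Λ_c ψ)(n) = Λ(c(n)) ψ(n)` for a coordinate function `c`. -/
def SwitchFunction.op (Λ : SwitchFunction) (N : ℕ) (c : ℤ × ℤ → ℤ) : Op N :=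
  lp.mapCLM 2
    (fun n : ℤ × ℤ => (Λ.toFun (c n) : ℂ) •
      ContinuousLinearMap.id ℂ (EuclideanSpace ℂ (Fin N)))
    Λ.exists_bound.choose_spec.1
    (fun n => by
      refine (norm_smul_le _ _).trans ?_
      rw [Complex.norm_real, Real.norm_eq_abs]
      exact (mul_le_of_le_one_right (abs_nonneg _) ContinuousLinearMap.norm_id_le).trans
        (Λ.exists_bound.choose_spec.2 _))

theorem SwitchFunction.op_apply (Λ : SwitchFunction) (N : ℕ) (c : ℤ × ℤ → ℤ) (ψ : HB N)
    (n : ℤ × ℤ) : Λ.op N c ψ n = (Λ.toFun (c n) : ℂ) • ψ n := by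
  simp [SwitchFunction.op]

/-- The switch function `Λ₁(n) = Λ(n₁)` in direction 1. -/
abbrev SwitchFunction.op₁ (Λ : SwitchFunction) (N : ℕ) : Op N := Λ.op N Prod.fst

/-- The switch function `Λ₂(n) = Λ(n₂)` in direction 2. -/
abbrev SwitchFunction.op₂ (Λ : SwitchFunction) (N : ℕ) : Op N := Λ.op N Prod.snd

/-! ### Trace class operators and the trace -/

/-- Trace class (nuclear) operators: `A = ∑ₖ |yₖ⟩⟨xₖ|` with `∑ₖ ‖xₖ‖ ‖yₖ‖ < ∞`. -/
def IsTraceClass {E : Type*} [NormedAddCommGroup E] [InnerProductSpace ℂ E]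
    (A : E →L[ℂ] E) : Prop :=
  ∃ x y : ℕ → E, Summable (fun k => ‖x k‖ * ‖y k‖) ∧
    ∀ ψ : E, HasSum (fun k => inner ℂ (x k) ψ • y k) (A ψ)

/-- The state at the site `p.1` with internal degree of freedom `p.2`. -/
def siteVec {N : ℕ} (p : (ℤ × ℤ) × Fin N) : HB N :=
  lp.single 2 p.1 (EuclideanSpace.single p.2 (1 : ℂ))

/-- The trace over the bulk Hilbert space, computed in the orthonormal basis of the lattice sites.
For trace class operators, any other orthonormal basis gives the same value, see
`IsTraceClass.hasSum_trace`. -/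
def trace {N : ℕ} (A : Op N) : ℂ :=
  ∑' p : (ℤ × ℤ) × Fin N, inner ℂ (siteVec p) (A (siteVec p))

theorem inner_siteVec {N : ℕ} (p : (ℤ × ℤ) × Fin N) (ψ : HB N) :
    inner ℂ (siteVec p) ψ = ψ p.1 p.2 := by
  rw [siteVec, lp.inner_single_left]
  exact (EuclideanSpace.inner_single_left p.2 (1 : ℂ) (ψ p.1)).trans (by simp)

/-- The lattice sites form an orthonormal basis. -/
theorem exists_siteBasis (N : ℕ) :
    ∃ b : HilbertBasis ((ℤ × ℤ) × Fin N) ℂ (HB N), ∀ p, b p = siteVec p := by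
  have ho : Orthonormal ℂ (siteVec (N := N)) := by
    rw [orthonormal_iff_ite]
    rintro ⟨m, i⟩ ⟨n, j⟩
    rw [inner_siteVec, siteVec]
    by_cases h : m = n
    · subst h
      have h2 := lp.single_apply_self (E := fun _ : ℤ × ℤ => EuclideanSpace ℂ (Fin N)) 2 m
        (EuclideanSpace.single j (1 : ℂ))
      change (lp.single (E := fun _ : ℤ × ℤ => EuclideanSpace ℂ (Fin N)) 2 m
        (EuclideanSpace.single j (1 : ℂ)) m).ofLp i = _
      rw [h2]
      simp
    · have h2 := lp.single_apply_ne (E := fun _ : ℤ × ℤ => EuclideanSpace ℂ (Fin N)) 2 n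
        (EuclideanSpace.single j (1 : ℂ)) h
      change (lp.single (E := fun _ : ℤ × ℤ => EuclideanSpace ℂ (Fin N)) 2 n
        (EuclideanSpace.single j (1 : ℂ)) m).ofLp i = _
      rw [h2]
      simp [h]
  refine ⟨HilbertBasis.mkOfOrthogonalEqBot ho ?_, fun p =>
    congrFun (HilbertBasis.coe_mkOfOrthogonalEqBot ho _) p⟩
  rw [Submodule.eq_bot_iff]
  intro ψ hψ
  ext n i
  have := (Submodule.mem_orthogonal _ _).1 hψ _ (Submodule.subset_span ⟨(n, i), rfl⟩)
  rw [inner_siteVec] at this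
  simpa using this

theorem IsTraceClass.exists_hasSum {E : Type*} [NormedAddCommGroup E] [InnerProductSpace ℂ E]
    {A : E →L[ℂ] E} (hA : IsTraceClass A) : ∃ τ : ℂ, ∀ {ι : Type} (b : HilbertBasis ι ℂ E),
      HasSum (fun i => inner ℂ (b i) (A (b i))) τ := by
  obtain ⟨x, y, hs, hA⟩ := hA
  refine ⟨∑' k, inner ℂ (x k) (y k), fun {ι} b => ?_⟩
  let F : ℕ × ι → ℂ := fun q => inner ℂ (x q.1) (b q.2) * inner ℂ (b q.2) (y q.1)
  have hcs : ∀ (u v : E) (s : Finset ι),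
      ∑ i ∈ s, ‖inner ℂ u (b i) * inner ℂ (b i) v‖ ≤ ‖u‖ * ‖v‖ := by
    intro u v s
    have h1 : ∑ i ∈ s, ‖inner ℂ (b i) u‖ ^ 2 ≤ ‖u‖ ^ 2 := b.orthonormal.sum_inner_products_le u
    have h2 : ∑ i ∈ s, ‖inner ℂ (b i) v‖ ^ 2 ≤ ‖v‖ ^ 2 := b.orthonormal.sum_inner_products_le v
    have h3 := Finset.sum_mul_sq_le_sq_mul_sq s (fun i => ‖inner ℂ (b i) u‖)
      (fun i => ‖inner ℂ (b i) v‖)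
    have h4 : (∑ i ∈ s, ‖inner ℂ u (b i) * inner ℂ (b i) v‖) ^ 2 ≤ (‖u‖ * ‖v‖) ^ 2 := by
      simp only [norm_mul, norm_inner_symm u]
      rw [mul_pow]
      exact h3.trans (mul_le_mul h1 h2 (by positivity) (by positivity))
    exact le_of_sq_le_sq h4 (by positivity)
  have hF : Summable F := by
    refine Summable.of_norm ?_
    rw [summable_prod_of_nonneg (fun _ => norm_nonneg _)]
    refine ⟨fun k => summable_of_sum_le (fun _ => norm_nonneg _) (hcs (x k) (y k)), ?_⟩
    refine hs.of_nonneg_of_le (fun k => tsum_nonneg fun _ => norm_nonneg _) (fun k => ?_)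
    exact Real.tsum_le_of_sum_le (fun _ => norm_nonneg _) (hcs (x k) (y k))
  have e1 : HasSum F (∑' k, inner ℂ (x k) (y k)) := by
    have := hF.hasSum
    rwa [hF.tsum_prod' (fun k => (b.hasSum_inner_mul_inner (x k) (y k)).summable),
      tsum_congr (fun k => b.tsum_inner_mul_inner (x k) (y k))] at this
  have e2 : HasSum (F ∘ Equiv.prodComm ι ℕ) (∑' k, inner ℂ (x k) (y k)) :=
    (Equiv.prodComm ι ℕ).hasSum_iff.2 e1
  refine e2.prod_fiberwise fun i => ?_
  have := (hA (b i)).mapL (innerSL ℂ (b i))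
  simpa [F, inner_smul_right] using this

/-- The trace of a trace class operator is the sum of its diagonal matrix elements in every
orthonormal basis. -/
theorem IsTraceClass.hasSum_trace {N : ℕ} {A : Op N} (hA : IsTraceClass A) {ι : Type}
    (b : HilbertBasis ι ℂ (HB N)) : HasSum (fun i => inner ℂ (b i) (A (b i))) (trace A) := by
  obtain ⟨τ, hτ⟩ := hA.exists_hasSum
  obtain ⟨b₀, hb₀⟩ := exists_siteBasis N
  have h := hτ b₀
  simp only [hb₀] at h
  rw [trace, h.tsum_eq]
  exact hτ b

/-! ### The bulk index -/

/-- The operator `W* ∂ₜW [W*[Λ₁,W], W*[Λ₂,W]]` at time `t`. -/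
def indexOperator {N : ℕ} (Λ₁ Λ₂ : SwitchFunction) (W : ℝ → Op N) (t : ℝ) : Op N :=
  star (W t) * strongDeriv W t *
    ⁅star (W t) * ⁅Λ₁.op₁ N, W t⁆, star (W t) * ⁅Λ₂.op₂ N, W t⁆⁆

/-- The value `½ ∫₀ᵀ Tr (W* ∂ₜW [W*[Λ₁,W], W*[Λ₂,W]]) dt`. -/
def indexIntegral {N : ℕ} (T : ℝ) (Λ₁ Λ₂ : SwitchFunction) (W : ℝ → Op N) : ℂ :=
  (1 / 2 : ℂ) * ∫ t in (0 : ℝ)..T, trace (indexOperator Λ₁ Λ₂ W t)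

/-- `HasBulkIndex T W c`: the bulk index of the family `W(t)`, `0 ≤ t ≤ T`, is well-defined with
value `c`. That is, for all switch functions, at almost all times the strong derivative of `W`
exists and the operator in the definition is trace class, its trace is integrable over `[0,T]`, and
the resulting value is `c`, whichever switch functions are used. -/
def HasBulkIndex {N : ℕ} (T : ℝ) (W : ℝ → Op N) (c : ℂ) : Prop :=
  ∀ Λ₁ Λ₂ : SwitchFunction,
    (∀ᵐ t ∂(volume.restrict (Icc 0 T)),
      (∃ A, HasStrongDerivAt W A t) ∧ IsTraceClass (indexOperator Λ₁ Λ₂ W t)) ∧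
    IntervalIntegrable (fun t => trace (indexOperator Λ₁ Λ₂ W t)) volume 0 T ∧
    indexIntegral T Λ₁ Λ₂ W = c

/-- The step function `n ↦ 1` for `n ≥ 0` and `n ↦ 0` for `n < 0`. -/
def SwitchFunction.step : SwitchFunction where
  toFun n := if 0 ≤ n then 1 else 0
  eventually_one := (eventually_ge_atTop 0).mono fun _ h => if_pos h
  eventually_zero := (eventually_lt_atBot 0).mono fun _ h => if_neg (not_le.2 h)

theorem HasBulkIndex.unique {N : ℕ} {T : ℝ} {W : ℝ → Op N} {c c' : ℂ}
    (h : HasBulkIndex T W c) (h' : HasBulkIndex T W c') : c = c' :=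
  (h .step .step).2.2.symm.trans (h' .step .step).2.2

end

end BulkIndex

namespace BulkIndex

noncomputable section

/-! ### Matrix elements -/

/-! Write $A_i=U^*[\Lambda_i,U]$, $A_t=U^*\partial_tU$ and $B_i=[\Lambda_i,V]V^*$,
$B_t=(\partial_tV)V^*$. These are left and right logarithmic derivatives along the commuting
derivations $\mathrm{ad}\,\Lambda_1$, $\mathrm{ad}\,\Lambda_2$, $\partial_t$, so they satisfy
zero-curvature identities: $[\Lambda_1,A_2]-[\Lambda_2,A_1]=-[A_1,A_2]$ and
$\partial_tA_i=[\Lambda_i,A_t]-[A_t,A_i]$, with the opposite sign of the quadratic terms for $B$.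
The index density is a noncommutative winding-number density, and additivity is its
Polyakov–Wiegmann formula: up to traceless commutators, the density of $UV$ minus those of $U$ and
$V$ is $-\partial_t\mathrm{Tr}(A_1B_2-A_2B_1)$ (`ring_mixed_terms`, `integral_density_mul`). The
boundary terms vanish because $A_i=B_i=0$ where $U=V=1$, that is at $t=0$ and $t=T$.

Independence of the switch functions has the same shape. Changing one of them by $\delta$ changes
the corresponding $A_i$ by $U^*\delta U-\delta$, and up to traceless commutators the density changes
by $\mp\partial_t\mathrm{Tr}\,\delta(A+B)$, where $A,B$ belong to the other direction
(`integral_trace_switch_difference`).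

The analysis makes the traces legitimate. A truncated exponential weight and Grönwall's inequality
show that $U(t)$ has exponentially decaying matrix elements (`IsPropagator.isLocal_zero`). A
commutator with $\Lambda_i$ adds decay away from the axis of that switch, and exponential decay
survives products (`IsLocal.mul`), so a product containing both commutators has absolutely summable
matrix elements. Two mechanisms kill traces: cyclicity, when the product is confined in both
directions, and the vanishing diagonal of $[\Lambda_i,X]$ for any $X$. Derivatives exist only
strongly and off a countable set, so the product rule uses uniform bounds, and the fundamental
theorem of calculus is applied to each diagonal entry and then summed by dominated convergence
(`IsConfined.integral_trace_deriv`). -/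

/-- The sites together with the internal degrees of freedom. -/
abbrev Site (N : ℕ) : Type := (ℤ × ℤ) × Fin N

/-- The matrix element `⟨p| A |q⟩`. -/
def entry {N : ℕ} (A : Op N) (p q : Site N) : ℂ := inner ℂ (siteVec p) (A (siteVec q))

/-- The orthonormal basis of lattice sites. -/
def siteBasis (N : ℕ) : HilbertBasis (Site N) ℂ (HB N) := (exists_siteBasis N).choose

variable {N : ℕ}

theorem siteBasis_apply (p : Site N) : siteBasis N p = siteVec p :=
  (exists_siteBasis N).choose_spec p

theorem norm_siteVec (p : Site N) : ‖siteVec p‖ = 1 := by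
  rw [← siteBasis_apply]; exact (siteBasis N).orthonormal.norm_eq_one p

theorem hasSum_inner_siteVec (ψ : HB N) :
    HasSum (fun p : Site N => inner ℂ (siteVec p) ψ • siteVec p) ψ := by
  have := (siteBasis N).hasSum_repr ψ
  simpa only [HilbertBasis.repr_apply_apply, siteBasis_apply] using this

theorem hasSum_inner_mul_inner_siteVec (φ ψ : HB N) :
    HasSum (fun p : Site N => inner ℂ φ (siteVec p) * inner ℂ (siteVec p) ψ) (inner ℂ φ ψ) := by
  simpa only [siteBasis_apply] using (siteBasis N).hasSum_inner_mul_inner φ ψ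

@[simp] theorem entry_add (A B : Op N) (p q : Site N) :
    entry (A + B) p q = entry A p q + entry B p q := by simp [entry]

@[simp] theorem entry_sub (A B : Op N) (p q : Site N) :
    entry (A - B) p q = entry A p q - entry B p q := by simp [entry]

@[simp] theorem entry_neg (A : Op N) (p q : Site N) : entry (-A) p q = -entry A p q := by
  simp [entry, inner_neg_right]

@[simp] theorem entry_smul (c : ℂ) (A : Op N) (p q : Site N) :
    entry (c • A) p q = c * entry A p q := by simp [entry]

theorem entry_star (A : Op N) (p q : Site N) : entry (star A) p q = star (entry A q p) := by
  simp [entry, ContinuousLinearMap.star_eq_adjoint, ContinuousLinearMap.adjoint_inner_right]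

theorem hasSum_entry_mul (A B : Op N) (p r : Site N) :
    HasSum (fun q => entry A p q * entry B q r) (entry (A * B) p r) := by
  have := hasSum_inner_mul_inner_siteVec (star A (siteVec p)) (B (siteVec r))
  simp only [ContinuousLinearMap.star_eq_adjoint, ContinuousLinearMap.adjoint_inner_left] at this
  exact this

theorem norm_entry_le_kernel (A : Op N) (p q : Site N) : ‖entry A p q‖ ≤ ‖kernel A p.1 q.1‖ := by
  have h : entry A p q = kernel A p.1 q.1 (EuclideanSpace.single q.2 1) p.2 := by
    rw [entry, inner_siteVec]; rfl
  rw [h]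
  refine (PiLp.norm_apply_le _ _).trans ((ContinuousLinearMap.le_opNorm _ _).trans ?_)
  simp

/-- Multiplication by a bounded function on the lattice. -/
def mulOp (f : ℤ × ℤ → ℝ) (C : ℝ) (hC : 0 ≤ C) (hf : ∀ n, |f n| ≤ C) : Op N :=
  lp.mapCLM 2
    (fun n : ℤ × ℤ => (f n : ℂ) • ContinuousLinearMap.id ℂ (EuclideanSpace ℂ (Fin N))) hC
    (fun n => by
      refine (norm_smul_le _ _).trans ?_
      rw [Complex.norm_real, Real.norm_eq_abs]
      exact (mul_le_of_le_one_right (abs_nonneg _) ContinuousLinearMap.norm_id_le).trans (hf n))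

theorem inner_siteVec_mulOp (f : ℤ × ℤ → ℝ) (C : ℝ) (hC : 0 ≤ C) (hf : ∀ n, |f n| ≤ C)
    (p : Site N) (ψ : HB N) :
    inner ℂ (siteVec p) (mulOp f C hC hf ψ) = f p.1 * inner ℂ (siteVec p) ψ := by
  simp [inner_siteVec, mulOp]

theorem inner_siteVec_op (Λ : SwitchFunction) (c : ℤ × ℤ → ℤ) (p : Site N) (ψ : HB N) :
    inner ℂ (siteVec p) (Λ.op N c ψ) = Λ.toFun (c p.1) * inner ℂ (siteVec p) ψ := by
  simp [inner_siteVec, SwitchFunction.op_apply]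

theorem ext_inner_siteVec {φ ψ : HB N}
    (h : ∀ p : Site N, inner ℂ (siteVec p) φ = inner ℂ (siteVec p) ψ) : φ = ψ := by
  rw [← (hasSum_inner_siteVec φ).tsum_eq, ← (hasSum_inner_siteVec ψ).tsum_eq]
  simp only [h]

theorem inner_siteVec_siteVec (p q : Site N) :
    inner ℂ (siteVec p) (siteVec q) = if p = q then (1 : ℂ) else 0 := by
  classical
  have := orthonormal_iff_ite.1 (siteBasis N).orthonormal p q
  simpa only [siteBasis_apply] using this

theorem op_siteVec (Λ : SwitchFunction) (c : ℤ × ℤ → ℤ) (p : Site N) :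
    Λ.op N c (siteVec p) = (Λ.toFun (c p.1) : ℂ) • siteVec p := by
  refine ext_inner_siteVec fun q => ?_
  rw [inner_siteVec_op, inner_smul_right, inner_siteVec_siteVec]
  split_ifs with h <;> simp [h]

theorem mulOp_siteVec (f : ℤ × ℤ → ℝ) (C : ℝ) (hC : 0 ≤ C) (hf : ∀ n, |f n| ≤ C)
    (p : Site N) : mulOp f C hC hf (siteVec p) = (f p.1 : ℂ) • siteVec p := by
  refine ext_inner_siteVec fun q => ?_
  rw [inner_siteVec_mulOp, inner_smul_right, inner_siteVec_siteVec]
  split_ifs with h <;> simp [h]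

theorem entry_op_mul (Λ : SwitchFunction) (c : ℤ × ℤ → ℤ) (A : Op N) (p q : Site N) :
    entry (Λ.op N c * A) p q = Λ.toFun (c p.1) * entry A p q := by
  simp [entry, inner_siteVec_op]

theorem entry_mul_op (Λ : SwitchFunction) (c : ℤ × ℤ → ℤ) (A : Op N) (p q : Site N) :
    entry (A * Λ.op N c) p q = Λ.toFun (c q.1) * entry A p q := by
  rw [entry, mul_apply_eq_comp, op_siteVec, map_smul, inner_smul_right, entry]

theorem entry_op (Λ : SwitchFunction) (c : ℤ × ℤ → ℤ) (p q : Site N) :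
    entry (Λ.op N c) p q = if p = q then (Λ.toFun (c p.1) : ℂ) else 0 := by
  rw [entry, inner_siteVec_op, inner_siteVec_siteVec]; simp

theorem entry_lie_op (Λ : SwitchFunction) (c : ℤ × ℤ → ℤ) (A : Op N) (p q : Site N) :
    entry ⁅Λ.op N c, A⁆ p q = ((Λ.toFun (c p.1) - Λ.toFun (c q.1) : ℝ) : ℂ) * entry A p q := by
  rw [Ring.lie_def, entry_sub, entry_op_mul, entry_mul_op]; push_cast; ring

theorem trace_eq_tsum_entry (A : Op N) : trace A = ∑' p, entry A p p := rfl

/-- A commutator with a multiplication operator vanishes on the diagonal. -/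
theorem trace_lie_op (Λ : SwitchFunction) (c : ℤ × ℤ → ℤ) (A : Op N) :
    trace ⁅Λ.op N c, A⁆ = 0 := by
  simp [trace_eq_tsum_entry, entry_lie_op]

/-! ### Exponential weights on the lattice -/

theorem latticeDist_nonneg (m n : ℤ × ℤ) : 0 ≤ latticeDist m n := by
  unfold latticeDist; positivity

theorem latticeDist_comm (m n : ℤ × ℤ) : latticeDist m n = latticeDist n m := by
  simp only [latticeDist, abs_sub_comm]

theorem latticeDist_self (m : ℤ × ℤ) : latticeDist m m = 0 := by simp [latticeDist]

theorem latticeDist_triangle (l m n : ℤ × ℤ) :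
    latticeDist l n ≤ latticeDist l m + latticeDist m n := by
  unfold latticeDist
  linarith [abs_sub_le (l.1 : ℝ) m.1 n.1, abs_sub_le (l.2 : ℝ) m.2 n.2]

theorem summable_exp_neg_mul_abs_int {ν : ℝ} (hν : 0 < ν) :
    Summable fun n : ℤ => Real.exp (-ν * |(n : ℝ)|) := by
  have h : Summable fun n : ℕ => Real.exp (-ν * n) := by
    simpa only [mul_comm] using Real.summable_exp_nat_mul_iff.2 (neg_lt_zero.2 hν)
  refine Summable.of_nat_of_neg ?_ ?_ <;> simpa using h

theorem summable_exp_latticeDist {ν : ℝ} (hν : 0 < ν) (n : ℤ × ℤ) :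
    Summable fun p : Site N => Real.exp (-ν * latticeDist n p.1) := by
  have h0 := (summable_exp_neg_mul_abs_int hν).mul_of_nonneg (summable_exp_neg_mul_abs_int hν)
    (fun _ => (Real.exp_pos _).le) (fun _ => (Real.exp_pos _).le)
  have h1 : Summable fun m : ℤ × ℤ => Real.exp (-ν * latticeDist n m) := by
    rw [← (Equiv.subLeft n).summable_iff] at h0
    refine h0.congr fun m => ?_
    simp only [Function.comp, latticeDist, Equiv.subLeft_apply, ← Real.exp_add, Prod.fst_sub,
      Prod.snd_sub, Int.cast_sub]
    ring_nf
  have h2 := h1.mul_of_nonneg (g := fun _ : Fin N => (1 : ℝ)) (Summable.of_finite)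
    (fun _ => (Real.exp_pos _).le) (fun _ => zero_le_one)
  simpa using h2

/-- The sum of the exponential weights around a site. -/
def expSum (N : ℕ) (ν : ℝ) : ℝ := ∑' p : Site N, Real.exp (-ν * latticeDist 0 p.1)

theorem tsum_exp_latticeDist (ν : ℝ) (n : ℤ × ℤ) :
    ∑' p : Site N, Real.exp (-ν * latticeDist n p.1) = expSum N ν := by
  rw [expSum, ← ((Equiv.addLeft n).prodCongr (Equiv.refl (Fin N))).tsum_eq]
  refine tsum_congr fun p => ?_
  simp [latticeDist]

theorem expSum_nonneg (ν : ℝ) : 0 ≤ expSum N ν := tsum_nonneg fun _ => (Real.exp_pos _).le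

/-! ### The Schur test -/

theorem sum_norm_inner_siteVec_sq_le (ψ : HB N) (F : Finset (Site N)) :
    ∑ p ∈ F, ‖(inner ℂ (siteVec p) ψ : ℂ)‖ ^ 2 ≤ ‖ψ‖ ^ 2 := by
  simpa only [siteBasis_apply] using (siteBasis N).orthonormal.sum_inner_products_le (s := F) ψ

theorem norm_sq_le_of_sum_le {ψ : HB N} {C : ℝ}
    (h : ∀ F : Finset (Site N), ∑ p ∈ F, ‖(inner ℂ (siteVec p) ψ : ℂ)‖ ^ 2 ≤ C) :
    ‖ψ‖ ^ 2 ≤ C := by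
  have h1 : HasSum (fun p : Site N => ‖(inner ℂ (siteVec p) ψ : ℂ)‖ ^ 2) (‖ψ‖ ^ 2) := by
    have := (hasSum_inner_mul_inner_siteVec ψ ψ).mapL Complex.reCLM
    have e : Complex.reCLM (inner ℂ ψ ψ) = ‖ψ‖ ^ 2 := by
      simpa using inner_self_eq_norm_sq (𝕜 := ℂ) ψ
    rw [e] at this
    refine this.congr_fun fun p => ?_
    rw [← inner_conj_symm ψ (siteVec p), RCLike.conj_mul]
    norm_cast
  exact hasSum_le_of_sum_le h1 h

/-- Schur test: by Cauchy–Schwarz with the exponential kernel as weight, row and column sums of the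
kernel, both at most `expSum N ν`, control the norm. -/
theorem opNorm_le_of_entry_le {A : Op N} {C ν : ℝ} (hν : 0 < ν) (hC : 0 ≤ C)
    (hA : ∀ p q : Site N, ‖entry A p q‖ ≤ C * Real.exp (-ν * latticeDist p.1 q.1)) :
    ‖A‖ ≤ C * expSum N ν := by
  set S := expSum N ν with hS
  have hS0 : 0 ≤ S := expSum_nonneg ν
  set g : Site N → Site N → ℝ := fun p q => Real.exp (-ν * latticeDist p.1 q.1) with hg
  have hg0 : ∀ p q, 0 ≤ g p q := fun p q => (Real.exp_pos _).le
  have hsum : ∀ (p : Site N) (F : Finset (Site N)), ∑ q ∈ F, g p q ≤ S := fun p F => by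
    rw [hS, ← tsum_exp_latticeDist ν p.1]
    exact (summable_exp_latticeDist hν p.1).sum_le_tsum F fun _ _ => (Real.exp_pos _).le
  have hsymm : ∀ p q, g p q = g q p := fun p q => by simp only [hg, latticeDist_comm]
  refine A.opNorm_le_bound (by positivity) fun ψ => ?_
  -- Finite truncations of `ψ` reduce the estimate to finite sums; continuity of `A` removes the
  -- truncation at the end.
  have key : ∀ F : Finset (Site N),
      ‖A (∑ q ∈ F, inner ℂ (siteVec q) ψ • siteVec q)‖ ≤ C * S * ‖ψ‖ := by
    intro F
    refine le_of_sq_le_sq (norm_sq_le_of_sum_le fun G => ?_) (by positivity)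
    have h1 : ∀ p : Site N,
        ‖(inner ℂ (siteVec p) (A (∑ q ∈ F, inner ℂ (siteVec q) ψ • siteVec q)) : ℂ)‖ ^ 2 ≤
          C ^ 2 * S * ∑ q ∈ F, g p q * ‖(inner ℂ (siteVec q) ψ : ℂ)‖ ^ 2 := by
      intro p
      have e : (inner ℂ (siteVec p) (A (∑ q ∈ F, inner ℂ (siteVec q) ψ • siteVec q)) : ℂ) =
          ∑ q ∈ F, inner ℂ (siteVec q) ψ * entry A p q := by
        simp [map_sum, entry]
      have h2 : ‖∑ q ∈ F, inner ℂ (siteVec q) ψ * entry A p q‖ ≤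
          C * ∑ q ∈ F, g p q * ‖(inner ℂ (siteVec q) ψ : ℂ)‖ := by
        refine (norm_sum_le _ _).trans ?_
        rw [Finset.mul_sum]
        refine Finset.sum_le_sum fun q _ => ?_
        rw [norm_mul]
        nlinarith [mul_le_mul_of_nonneg_left (hA p q) (norm_nonneg (inner ℂ (siteVec q) ψ : ℂ))]
      have h3 := Finset.sum_sq_le_sum_mul_sum_of_sq_le_mul F
        (r := fun q => g p q * ‖(inner ℂ (siteVec q) ψ : ℂ)‖) (f := fun q => g p q)
        (g := fun q => g p q * ‖(inner ℂ (siteVec q) ψ : ℂ)‖ ^ 2)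
        (fun q _ => hg0 p q) (fun q _ => by have := hg0 p q; positivity)
        (fun q _ => le_of_eq (by ring))
      rw [e]
      calc _ ≤ (C * ∑ q ∈ F, g p q * ‖(inner ℂ (siteVec q) ψ : ℂ)‖) ^ 2 := by gcongr
        _ ≤ C ^ 2 * ((∑ q ∈ F, g p q) * ∑ q ∈ F, g p q * ‖(inner ℂ (siteVec q) ψ : ℂ)‖ ^ 2) := by
            rw [mul_pow]; gcongr
        _ ≤ C ^ 2 * (S * ∑ q ∈ F, g p q * ‖(inner ℂ (siteVec q) ψ : ℂ)‖ ^ 2) := by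
            gcongr
            exact hsum p F
        _ = _ := by ring
    refine (Finset.sum_le_sum fun p _ => h1 p).trans ?_
    rw [← Finset.mul_sum, Finset.sum_comm]
    have h4 : ∑ q ∈ F, ∑ p ∈ G, g p q * ‖(inner ℂ (siteVec q) ψ : ℂ)‖ ^ 2 ≤ S * ‖ψ‖ ^ 2 := by
      calc _ ≤ ∑ q ∈ F, S * ‖(inner ℂ (siteVec q) ψ : ℂ)‖ ^ 2 := by
            refine Finset.sum_le_sum fun q _ => ?_
            rw [← Finset.sum_mul]
            gcongr
            simpa only [hsymm _ q] using hsum q G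
        _ ≤ _ := by
            rw [← Finset.mul_sum]
            gcongr
            exact sum_norm_inner_siteVec_sq_le ψ F
    calc _ ≤ C ^ 2 * S * (S * ‖ψ‖ ^ 2) := by gcongr
      _ = _ := by ring
  exact le_of_tendsto (((A.continuous.tendsto ψ).comp (hasSum_inner_siteVec ψ)).norm)
    (Eventually.of_forall key)

/-! ### Families of local operators, confined along the coordinate axes -/

/-- The exponent that measures distance from the diagonal, and from the lines `p.1 = 0` (`a` times)
and `p.2 = 0` (`b` times). -/
def decayExponent (a b : ℕ) (p q : ℤ × ℤ) : ℝ :=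
  latticeDist p q + a * |(p.1 : ℝ)| + b * |(p.2 : ℝ)|

theorem decayExponent_nonneg (a b : ℕ) (p q : ℤ × ℤ) : 0 ≤ decayExponent a b p q := by
  have := latticeDist_nonneg p q
  unfold decayExponent; positivity

theorem decayExponent_mono {a b a' b' : ℕ} (ha : a' ≤ a) (hb : b' ≤ b) (p q : ℤ × ℤ) :
    decayExponent a' b' p q ≤ decayExponent a b p q := by
  unfold decayExponent; gcongr

/-- The matrix elements of `X t` decay exponentially away from the diagonal, away from the line
`p.1 = 0` if `0 < a`, and away from the line `p.2 = 0` if `0 < b`, uniformly in `t ∈ [0,T]`. -/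
def IsLocal (T : ℝ) (a b : ℕ) (X : ℝ → Op N) : Prop :=
  ∃ ν C : ℝ, 0 < ν ∧ 0 ≤ C ∧ ∀ t ∈ Icc 0 T, ∀ p q : Site N,
    ‖entry (X t) p q‖ ≤ C * Real.exp (-ν * decayExponent a b p.1 q.1)

theorem exp_neg_mul_le {ν ν' x y : ℝ} (hν : ν' ≤ ν) (hν' : 0 ≤ ν') (hy : 0 ≤ y) (hxy : y ≤ x) :
    Real.exp (-ν * x) ≤ Real.exp (-ν' * y) := by
  rw [Real.exp_le_exp]
  nlinarith [mul_le_mul hν hxy hy (hν'.trans hν)]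

variable {T : ℝ} {a b a' b' : ℕ} {X Y : ℝ → Op N}

theorem IsLocal.mono (hX : IsLocal T a b X) (ha : a' ≤ a) (hb : b' ≤ b) : IsLocal T a' b' X := by
  obtain ⟨ν, C, hν, hC, h⟩ := hX
  refine ⟨ν, C, hν, hC, fun t ht p q => (h t ht p q).trans ?_⟩
  gcongr ?_ * ?_
  exact exp_neg_mul_le le_rfl hν.le (decayExponent_nonneg _ _ _ _) (decayExponent_mono ha hb _ _)

theorem IsLocal.neg (hX : IsLocal T a b X) : IsLocal T a b (fun t => -X t) := by
  obtain ⟨ν, C, hν, hC, h⟩ := hX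
  exact ⟨ν, C, hν, hC, fun t ht p q => by simpa using h t ht p q⟩

theorem IsLocal.smul (hX : IsLocal T a b X) (c : ℂ) : IsLocal T a b (fun t => c • X t) := by
  obtain ⟨ν, C, hν, hC, h⟩ := hX
  refine ⟨ν, ‖c‖ * C, hν, by positivity, fun t ht p q => ?_⟩
  rw [entry_smul, norm_mul, mul_assoc]
  gcongr
  exact h t ht p q

theorem IsLocal.add (hX : IsLocal T a b X) (hY : IsLocal T a b Y) :
    IsLocal T a b (fun t => X t + Y t) := by
  obtain ⟨ν, C, hν, hC, h⟩ := hX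
  obtain ⟨ν', C', hν', hC', h'⟩ := hY
  refine ⟨min ν ν', C + C', lt_min hν hν', by positivity, fun t ht p q => ?_⟩
  have h0 := decayExponent_nonneg a b p.1 q.1
  rw [entry_add, add_mul]
  refine (norm_add_le _ _).trans (add_le_add ?_ ?_)
  · refine (h t ht p q).trans ?_
    gcongr ?_ * ?_
    exact exp_neg_mul_le (min_le_left _ _) (lt_min hν hν').le h0 le_rfl
  · refine (h' t ht p q).trans ?_
    gcongr ?_ * ?_
    exact exp_neg_mul_le (min_le_right _ _) (lt_min hν hν').le h0 le_rfl

theorem IsLocal.sub (hX : IsLocal T a b X) (hY : IsLocal T a b Y) :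
    IsLocal T a b (fun t => X t - Y t) := by
  simpa only [sub_eq_add_neg] using hX.add hY.neg

/-- Moving the weights of the second factor from the row `q` to the row `p` costs `a' + b'` copies
of `latticeDist p q`, whence the reduced rate. Half of `latticeDist p q` is kept aside to make the
sum over the intermediate site `q` converge. -/
theorem decayExponent_mul_le (a b a' b' : ℕ) (p q r : ℤ × ℤ) :
    latticeDist p q / 2 + decayExponent (a + a') (b + b') p r / (4 * (1 + a' + b')) ≤
      decayExponent a b p q + decayExponent a' b' q r := by
  have h0 := latticeDist_nonneg p q
  have h0' := latticeDist_nonneg q r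
  have h1 := latticeDist_triangle p q r
  have e1 : |(p.1 : ℝ)| ≤ latticeDist p q + |(q.1 : ℝ)| := by
    have := abs_sub_abs_le_abs_sub (p.1 : ℝ) q.1
    have := abs_nonneg ((p.2 : ℝ) - q.2)
    unfold latticeDist; linarith
  have e2 : |(p.2 : ℝ)| ≤ latticeDist p q + |(q.2 : ℝ)| := by
    have := abs_sub_abs_le_abs_sub (p.2 : ℝ) q.2
    have := abs_nonneg ((p.1 : ℝ) - q.1)
    unfold latticeDist; linarith
  have f1 := mul_le_mul_of_nonneg_left e1 (Nat.cast_nonneg (α := ℝ) a')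
  have f2 := mul_le_mul_of_nonneg_left e2 (Nat.cast_nonneg (α := ℝ) b')
  have ha : (0 : ℝ) ≤ a := Nat.cast_nonneg a
  have hb : (0 : ℝ) ≤ b := Nat.cast_nonneg b
  have ha' : (0 : ℝ) ≤ a' := Nat.cast_nonneg a'
  have hb' : (0 : ℝ) ≤ b' := Nat.cast_nonneg b'
  have p1 := mul_nonneg ha (abs_nonneg (p.1 : ℝ))
  have p2 := mul_nonneg hb (abs_nonneg (p.2 : ℝ))
  have q1 := mul_nonneg ha' (abs_nonneg (q.1 : ℝ))
  have q2 := mul_nonneg hb' (abs_nonneg (q.2 : ℝ))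
  have h2 : decayExponent (a + a') (b + b') p r ≤ (1 + a' + b') * (latticeDist p q +
      latticeDist q r + a * |(p.1 : ℝ)| + b * |(p.2 : ℝ)| + a' * |(q.1 : ℝ)| + b' * |(q.2 : ℝ)|) := by
    have g : ∀ x : ℝ, 0 ≤ x → 0 ≤ (a' + b') * x := fun x hx => by positivity
    have := g _ h0'
    have := g _ p1
    have := g _ p2
    have := g _ q1
    have := g _ q2
    unfold decayExponent
    push_cast
    linarith
  have h3 : decayExponent (a + a') (b + b') p r / (4 * (1 + a' + b')) ≤ (latticeDist p q +
      latticeDist q r + a * |(p.1 : ℝ)| + b * |(p.2 : ℝ)| + a' * |(q.1 : ℝ)| + b' * |(q.2 : ℝ)|) / 4 := by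
    rw [div_le_iff₀ (by positivity)]
    linarith
  unfold decayExponent at *
  linarith

theorem IsLocal.mul (hX : IsLocal T a b X) (hY : IsLocal T a' b' Y) :
    IsLocal T (a + a') (b + b') (fun t => X t * Y t) := by
  obtain ⟨ν, C, hν, hC, h⟩ := hX
  obtain ⟨ν', C', hν', hC', h'⟩ := hY
  set μ := min ν ν' with hμ
  have hμ0 : 0 < μ := lt_min hν hν'
  -- The rate is the one left by `decayExponent_mul_le`; `expSum N (μ / 2)` is the sum over the
  -- intermediate site.
  refine ⟨μ / (4 * (1 + a' + b')), C * C' * expSum N (μ / 2), by positivity,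
    mul_nonneg (by positivity) (expSum_nonneg _), fun t ht p r => ?_⟩
  have hb : ∀ q : Site N, ‖entry (X t) p q * entry (Y t) q r‖ ≤
      C * C' * Real.exp (-(μ / (4 * (1 + a' + b'))) * decayExponent (a + a') (b + b') p.1 r.1) *
        Real.exp (-(μ / 2) * latticeDist p.1 q.1) := by
    intro q
    rw [norm_mul]
    have h1 := (h t ht p q).trans (mul_le_mul_of_nonneg_left (exp_neg_mul_le (min_le_left ν ν')
      hμ0.le (decayExponent_nonneg _ _ _ _) le_rfl) hC)
    have h2 := (h' t ht q r).trans (mul_le_mul_of_nonneg_left (exp_neg_mul_le (min_le_right ν ν')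
      hμ0.le (decayExponent_nonneg _ _ _ _) le_rfl) hC')
    refine (mul_le_mul h1 h2 (norm_nonneg _) (by positivity)).trans ?_
    rw [← hμ, mul_mul_mul_comm, mul_assoc (C * C'), ← Real.exp_add, ← Real.exp_add]
    refine mul_le_mul_of_nonneg_left (Real.exp_le_exp.2 ?_) (by positivity)
    have := mul_le_mul_of_nonneg_left (decayExponent_mul_le a b a' b' p.1 q.1 r.1) hμ0.le
    have e : μ * (decayExponent (a + a') (b + b') p.1 r.1 / (4 * (1 + a' + b'))) =
      μ / (4 * (1 + a' + b')) * decayExponent (a + a') (b + b') p.1 r.1 := by ring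
    linarith
  have hs := (summable_exp_latticeDist (N := N) (half_pos hμ0) p.1).mul_left
    (C * C' * Real.exp (-(μ / (4 * (1 + a' + b'))) * decayExponent (a + a') (b + b') p.1 r.1))
  have := tsum_of_norm_bounded hs.hasSum hb
  rw [(hasSum_entry_mul (X t) (Y t) p r).tsum_eq, tsum_mul_left, tsum_exp_latticeDist] at this
  refine this.trans (le_of_eq ?_)
  ring

theorem IsLocal.star (hX : IsLocal T 0 0 X) : IsLocal T 0 0 (fun t => star (X t)) := by
  obtain ⟨ν, C, hν, hC, h⟩ := hX
  refine ⟨ν, C, hν, hC, fun t ht p q => ?_⟩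
  rw [entry_star, norm_star]
  simpa [decayExponent, latticeDist_comm] using h t ht q p

/-- If `m` lies beyond the transition region by more than its distance to `n`, then `n` lies beyond
it on the same side, where the switch is constant. -/
theorem SwitchFunction.exists_abs_le (Λ : SwitchFunction) : ∃ R : ℝ, 0 ≤ R ∧ ∀ m n : ℤ,
    Λ.toFun m ≠ Λ.toFun n → |(m : ℝ)| ≤ R + |(m : ℝ) - n| := by
  obtain ⟨r, hr⟩ := eventually_atTop.1 Λ.eventually_one
  obtain ⟨l, hl⟩ := eventually_atBot.1 Λ.eventually_zero
  refine ⟨|(r : ℝ)| + |(l : ℝ)|, by positivity, fun m n hmn => ?_⟩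
  by_contra! hlt
  have hr' := le_abs_self (r : ℝ)
  have hl' := neg_abs_le (l : ℝ)
  have h1 := abs_nonneg (r : ℝ)
  have h2 := abs_nonneg (l : ℝ)
  have h3 := le_abs_self ((m : ℝ) - n)
  have h4 := neg_abs_le ((m : ℝ) - n)
  rcases abs_cases (m : ℝ) with ⟨e, _⟩ | ⟨e, _⟩ <;> rw [e] at hlt
  · refine hmn ?_
    rw [hr m, hr n]
    · have : (r : ℝ) ≤ n := by linarith
      exact_mod_cast this
    · have : (r : ℝ) ≤ m := by linarith [abs_nonneg ((m : ℝ) - n)]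
      exact_mod_cast this
  · refine hmn ?_
    rw [hl m, hl n]
    · have : (n : ℝ) ≤ l := by linarith
      exact_mod_cast this
    · have : (m : ℝ) ≤ l := by linarith [abs_nonneg ((m : ℝ) - n)]
      exact_mod_cast this

/-- Commutators with a switch function are confined along the switch. -/
theorem IsLocal.lie_op (Λ : SwitchFunction) (c : ℤ × ℤ → ℤ) (i j : ℕ)
    (hc : ∀ p q : ℤ × ℤ, |(c p : ℝ) - c q| ≤ latticeDist p q)
    (hij : ∀ p : ℤ × ℤ, i * |(p.1 : ℝ)| + j * |(p.2 : ℝ)| = |(c p : ℝ)|) (hX : IsLocal T a b X) :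
    IsLocal T (a + i) (b + j) (fun t => ⁅Λ.op N c, X t⁆) := by
  obtain ⟨ν, C, hν, hC, h⟩ := hX
  obtain ⟨B, hB, hΛ⟩ := Λ.exists_bound
  obtain ⟨R, hR, hR'⟩ := Λ.exists_abs_le
  -- Where the commutator is nonzero, the distance to the axis is at most `R` plus the distance from
  -- the diagonal. Half of the decay rate therefore pays for the new weight, and `exp (ν / 2 * R)`
  -- absorbs the offset.
  refine ⟨ν / 2, 2 * B * C * Real.exp (ν / 2 * R), half_pos hν, by positivity, fun t ht p q => ?_⟩
  rw [entry_lie_op, norm_mul, Complex.norm_real, Real.norm_eq_abs]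
  by_cases hpq : Λ.toFun (c p.1) = Λ.toFun (c q.1)
  · rw [hpq, sub_self, abs_zero, zero_mul]; positivity
  have h1 : |Λ.toFun (c p.1) - Λ.toFun (c q.1)| ≤ 2 * B := by
    linarith [abs_sub (Λ.toFun (c p.1)) (Λ.toFun (c q.1)), hΛ (c p.1), hΛ (c q.1)]
  refine (mul_le_mul h1 (h t ht p q) (norm_nonneg _) (by positivity)).trans ?_
  rw [mul_assoc _ (Real.exp _), ← Real.exp_add, ← mul_assoc]
  gcongr
  have h2 := hR' _ _ hpq
  have h3 := hc p.1 q.1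
  have h4 : decayExponent (a + i) (b + j) p.1 q.1 ≤ 2 * decayExponent a b p.1 q.1 + R := by
    have h5 := hij p.1
    have : 0 ≤ a * |(p.1.1 : ℝ)| := by positivity
    have : 0 ≤ b * |(p.1.2 : ℝ)| := by positivity
    unfold decayExponent
    push_cast
    linarith
  nlinarith [mul_le_mul_of_nonneg_left h4 hν.le]

theorem IsLocal.lie_op₁ (Λ : SwitchFunction) (hX : IsLocal T a b X) :
    IsLocal T (a + 1) b (fun t => ⁅Λ.op₁ N, X t⁆) := by
  refine hX.lie_op Λ Prod.fst 1 0 (fun p q => ?_) (fun p => by simp)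
  unfold latticeDist; linarith [abs_nonneg ((p.2 : ℝ) - q.2)]

theorem IsLocal.lie_op₂ (Λ : SwitchFunction) (hX : IsLocal T a b X) :
    IsLocal T a (b + 1) (fun t => ⁅Λ.op₂ N, X t⁆) := by
  refine hX.lie_op Λ Prod.snd 0 1 (fun p q => ?_) (fun p => by simp)
  unfold latticeDist; linarith [abs_nonneg ((p.1 : ℝ) - q.1)]

theorem SwitchFunction.exists_sub_eq_zero (Λ Λ' : SwitchFunction) : ∃ R : ℝ, ∀ n : ℤ,
    Λ.toFun n ≠ Λ'.toFun n → |(n : ℝ)| ≤ R := by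
  obtain ⟨r, hr⟩ := eventually_atTop.1 (Λ.eventually_one.and Λ'.eventually_one)
  obtain ⟨l, hl⟩ := eventually_atBot.1 (Λ.eventually_zero.and Λ'.eventually_zero)
  refine ⟨max |(r : ℝ)| |(l : ℝ)|, fun n hn => ?_⟩
  have h1 : n ≤ r := by
    by_contra! h
    exact hn ((hr n h.le).1.trans (hr n h.le).2.symm)
  have h2 : l ≤ n := by
    by_contra! h
    exact hn ((hl n h.le).1.trans (hl n h.le).2.symm)
  rw [max_comm]
  exact abs_le_max_abs_abs (by exact_mod_cast h2) (by exact_mod_cast h1)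

/-- The difference of two switch functions is confined along the switch. -/
theorem isLocal_op_sub_op (Λ Λ' : SwitchFunction) (c : ℤ × ℤ → ℤ) (i j : ℕ)
    (hij : ∀ p : ℤ × ℤ, i * |(p.1 : ℝ)| + j * |(p.2 : ℝ)| = |(c p : ℝ)|) :
    IsLocal T i j (fun _ => Λ.op N c - Λ'.op N c) := by
  obtain ⟨B, hB, hΛ⟩ := Λ.exists_bound
  obtain ⟨B', hB', hΛ'⟩ := Λ'.exists_bound
  obtain ⟨R, hR⟩ := Λ.exists_sub_eq_zero Λ'
  -- The operator is diagonal and supported in the strip `|c p| ≤ R`, so any positive rate would do.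
  refine ⟨1, (B + B') * Real.exp R, one_pos, by positivity, fun t _ p q => ?_⟩
  rw [entry_sub, entry_op, entry_op]
  split_ifs with hpq
  · subst hpq
    rw [← Complex.ofReal_sub, Complex.norm_real, Real.norm_eq_abs]
    by_cases h : Λ.toFun (c p.1) = Λ'.toFun (c p.1)
    · rw [h, sub_self, abs_zero]; positivity
    · have h1 : |Λ.toFun (c p.1) - Λ'.toFun (c p.1)| ≤ B + B' := by
        linarith [abs_sub (Λ.toFun (c p.1)) (Λ'.toFun (c p.1)), hΛ (c p.1), hΛ' (c p.1)]
      have h2 := hR _ h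
      rw [mul_assoc, ← Real.exp_add, decayExponent, latticeDist_self, add_assoc, hij]
      exact h1.trans (le_mul_of_one_le_right (by positivity) (Real.one_le_exp (by linarith)))
  · simp only [sub_self, norm_zero]; positivity

/-! ### Traces of confined operators -/

theorem summable_exp_decayExponent {ν : ℝ} (hν : 0 < ν) :
    Summable fun x : Site N × Site N => Real.exp (-ν * decayExponent 1 1 x.1.1 x.2.1) := by
  have e : ∀ p q : Site N, Real.exp (-ν * decayExponent 1 1 p.1 q.1) =
      Real.exp (-ν * latticeDist 0 p.1) * Real.exp (-ν * latticeDist p.1 q.1) := by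
    intro p q
    rw [← Real.exp_add]
    congr 1
    simp only [decayExponent, latticeDist, Prod.fst_zero, Prod.snd_zero, Int.cast_zero, zero_sub,
      abs_neg]
    push_cast
    ring
  rw [summable_prod_of_nonneg fun _ => (Real.exp_pos _).le]
  simp only [e, tsum_mul_left, tsum_exp_latticeDist]
  exact ⟨fun p => (summable_exp_latticeDist hν p.1).mul_left _,
    (summable_exp_latticeDist hν 0).mul_right _⟩

theorem IsLocal.exists_summable (hX : IsLocal T 1 1 X) : ∃ f : Site N × Site N → ℝ, Summable f ∧
    ∀ t ∈ Icc 0 T, ∀ p q, ‖entry (X t) p q‖ ≤ f (p, q) := by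
  obtain ⟨ν, C, hν, hC, h⟩ := hX
  exact ⟨_, (summable_exp_decayExponent hν).mul_left C, fun t ht p q => h t ht p q⟩

/-- The decomposition is `A = ∑ |A e_q⟩⟨e_q|` over the site basis; the norm of each column is at
most the sum of the absolute values of its entries. -/
theorem isTraceClass_of_summable_entry {A : Op N}
    (hA : Summable fun x : Site N × Site N => ‖entry A x.1 x.2‖) : IsTraceClass A := by
  have hA' : Summable fun x : Site N × Site N => ‖entry A x.2 x.1‖ :=
    (Equiv.prodComm (Site N) (Site N)).summable_iff.2 hA
  have hcol : Summable fun q : Site N => ‖A (siteVec q)‖ := by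
    refine hA'.prod.of_nonneg_of_le (fun _ => norm_nonneg _) fun q => ?_
    rw [← (hasSum_inner_siteVec (A (siteVec q))).tsum_eq]
    have : ∀ p, ‖(inner ℂ (siteVec p) (A (siteVec q)) : ℂ) • siteVec p‖ = ‖entry A p q‖ :=
      fun p => by rw [norm_smul, norm_siteVec, mul_one, entry]
    refine (norm_tsum_le_tsum_norm ?_).trans (le_of_eq (tsum_congr this))
    simpa only [this] using hA'.prod_factor q
  -- `IsTraceClass` asks for sequences over `ℕ`, so the families over the sites are transported by
  -- an encoding and extended by zero.
  let e : Site N → ℕ := Encodable.encode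
  have he : Function.Injective e := Encodable.encode_injective
  refine ⟨Function.extend e siteVec 0, Function.extend e (fun q => A (siteVec q)) 0, ?_,
    fun ψ => ?_⟩
  · refine (he.summable_iff fun k hk => ?_).1 ?_
    · rw [Function.extend_apply' _ _ _ hk]; simp
    · refine hcol.congr fun q => ?_
      simp [he.extend_apply, norm_siteVec]
  · refine (he.hasSum_iff fun k hk => ?_).1 ?_
    · rw [Function.extend_apply' _ _ _ hk]; simp
    · have := (hasSum_inner_siteVec ψ).mapL A
      refine this.congr_fun fun q => ?_
      simp [he.extend_apply]

theorem IsLocal.summable_entry (hX : IsLocal T 1 1 X) {t : ℝ} (ht : t ∈ Icc 0 T) :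
    Summable fun x : Site N × Site N => ‖entry (X t) x.1 x.2‖ := by
  obtain ⟨f, hf, h⟩ := hX.exists_summable
  exact hf.of_nonneg_of_le (fun _ => norm_nonneg _) fun x => h t ht x.1 x.2

theorem IsLocal.isTraceClass (hX : IsLocal T 1 1 X) {t : ℝ} (ht : t ∈ Icc 0 T) :
    IsTraceClass (X t) :=
  isTraceClass_of_summable_entry (hX.summable_entry ht)

theorem IsLocal.summable_diag (hX : IsLocal T 1 1 X) {t : ℝ} (ht : t ∈ Icc 0 T) :
    Summable fun p : Site N => entry (X t) p p :=
  ((hX.summable_entry ht).comp_injective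
    (i := fun p : Site N => (p, p)) fun _ _ h => (Prod.ext_iff.1 h).1).of_norm

theorem IsLocal.trace_add (hX : IsLocal T 1 1 X) (hY : IsLocal T 1 1 Y) {t : ℝ}
    (ht : t ∈ Icc 0 T) : trace (X t + Y t) = trace (X t) + trace (Y t) := by
  simp only [trace_eq_tsum_entry, entry_add]
  exact (hX.summable_diag ht).tsum_add (hY.summable_diag ht)

theorem trace_neg (A : Op N) : trace (-A) = -trace A := by
  simp only [trace_eq_tsum_entry, entry_neg, tsum_neg]

theorem IsLocal.trace_sub (hX : IsLocal T 1 1 X) (hY : IsLocal T 1 1 Y) {t : ℝ}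
    (ht : t ∈ Icc 0 T) : trace (X t - Y t) = trace (X t) - trace (Y t) := by
  rw [sub_eq_add_neg, hX.trace_add hY.neg ht, trace_neg, sub_eq_add_neg]

/-- Neither factor need be trace class: it suffices that the two together are confined in both
directions. Then the double sum of `X_pq Y_qp` converges absolutely and may be exchanged. -/
theorem IsLocal.trace_mul_comm (hX : IsLocal T a b X) (hY : IsLocal T a' b' Y) (ha : 1 ≤ a + a')
    (hb : 1 ≤ b + b') {t : ℝ} (ht : t ∈ Icc 0 T) : trace (X t * Y t) = trace (Y t * X t) := by
  have hs : Summable fun x : Site N × Site N => entry (X t) x.1 x.2 * entry (Y t) x.2 x.1 := by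
    obtain ⟨ν, C, hν, hC, h⟩ := hX
    obtain ⟨ν', C', hν', hC', h'⟩ := hY
    set μ := min ν ν' with hμ
    have hμ0 : 0 < μ := lt_min hν hν'
    refine Summable.of_norm_bounded
      ((summable_exp_decayExponent (N := N) (ν := μ / (4 * (1 + a' + b'))) (by positivity)).mul_left
        (C * C')) fun x => ?_
    obtain ⟨p, q⟩ := x
    rw [norm_mul]
    have h1 := (h t ht p q).trans (mul_le_mul_of_nonneg_left (exp_neg_mul_le (min_le_left ν ν')
      hμ0.le (decayExponent_nonneg _ _ _ _) le_rfl) hC)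
    have h2 := (h' t ht q p).trans (mul_le_mul_of_nonneg_left (exp_neg_mul_le (min_le_right ν ν')
      hμ0.le (decayExponent_nonneg _ _ _ _) le_rfl) hC')
    refine (mul_le_mul h1 h2 (norm_nonneg _) (by positivity)).trans ?_
    rw [← hμ, mul_mul_mul_comm, ← Real.exp_add]
    gcongr
    have h3 := decayExponent_mul_le a b a' b' p.1 q.1 p.1
    have h4 : decayExponent 1 1 p.1 q.1 / (4 * (1 + a' + b')) ≤
        latticeDist p.1 q.1 / 2 +
          decayExponent (a + a') (b + b') p.1 p.1 / (4 * (1 + a' + b')) := by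
      have h5 := decayExponent_mono ha hb p.1 p.1
      have h6 := latticeDist_nonneg p.1 q.1
      have h7 : decayExponent 1 1 p.1 q.1 ≤
          latticeDist p.1 q.1 + decayExponent (a + a') (b + b') p.1 p.1 := by
        unfold decayExponent at h5 ⊢
        rw [latticeDist_self] at h5 ⊢
        linarith
      rw [div_add_div _ _ two_ne_zero (by positivity), div_le_div_iff₀ (by positivity)
        (by positivity)]
      have ha' : (0 : ℝ) ≤ a' := Nat.cast_nonneg a'
      have hb' : (0 : ℝ) ≤ b' := Nat.cast_nonneg b'
      have : 0 ≤ (4 * (1 + a' + b') : ℝ) := by positivity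
      have h8 : latticeDist p.1 q.1 * 2 ≤ latticeDist p.1 q.1 * (4 * (1 + a' + b')) := by
        gcongr; linarith
      nlinarith [mul_le_mul_of_nonneg_right h7 this, mul_le_mul_of_nonneg_right h8 this]
    have := mul_le_mul_of_nonneg_left (h4.trans h3) hμ0.le
    have e : μ * (decayExponent 1 1 p.1 q.1 / (4 * (1 + a' + b'))) =
      μ / (4 * (1 + a' + b')) * decayExponent 1 1 p.1 q.1 := by ring
    linarith
  simp only [trace_eq_tsum_entry]
  calc _ = ∑' p, ∑' q, entry (X t) p q * entry (Y t) q p :=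
        tsum_congr fun p => (hasSum_entry_mul _ _ p p).tsum_eq.symm
    _ = ∑' q, ∑' p, entry (X t) p q * entry (Y t) q p :=
        (Summable.tsum_comm (f := fun p q => entry (X t) p q * entry (Y t) q p) hs).symm
    _ = _ := tsum_congr fun q => by
        rw [← (hasSum_entry_mul _ _ q q).tsum_eq]
        exact tsum_congr fun p => mul_comm _ _

/-! ### Strong continuity and strong derivatives of products -/

section Strong

variable {E : Type*} [NormedAddCommGroup E] [NormedSpace ℂ E] {X Y : ℝ → (E →L[ℂ] E)}
  {A B : E →L[ℂ] E} {t C : ℝ}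

/-- Multiplication is strongly continuous only on bounded sets, which is why a uniform norm bound
accompanies every family below. -/
theorem tendsto_apply_of_bounded {ι : Type*} {l : Filter ι} {Z : ι → (E →L[ℂ] E)} {f : ι → E}
    {x y : E} (hZ : ∀ i, ‖Z i‖ ≤ C) (hx : Tendsto (fun i => Z i x) l (𝓝 y))
    (hf : Tendsto f l (𝓝 x)) : Tendsto (fun i => Z i (f i)) l (𝓝 y) := by
  have h1 : Tendsto (fun i => Z i (f i - x)) l (𝓝 0) := by
    refine squeeze_zero_norm (a := fun i => C * ‖f i - x‖) (fun i => ?_) ?_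
    · exact (Z i).le_of_opNorm_le (hZ i) _
    · simpa using (tendsto_iff_norm_sub_tendsto_zero.1 hf).const_mul C
  simpa using h1.add hx

theorem StronglyContinuousAt.mul (hC : ∀ s, ‖X s‖ ≤ C) (hX : StronglyContinuousAt X t)
    (hY : StronglyContinuousAt Y t) : StronglyContinuousAt (fun s => X s * Y s) t :=
  fun ψ => tendsto_apply_of_bounded (Z := X) (f := fun s => Y s ψ) hC (hX (Y t ψ)) (hY ψ)

theorem StronglyContinuousAt.add (hX : StronglyContinuousAt X t)
    (hY : StronglyContinuousAt Y t) : StronglyContinuousAt (fun s => X s + Y s) t :=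
  fun ψ => (hX ψ).add (hY ψ)

theorem StronglyContinuousAt.neg (hX : StronglyContinuousAt X t) :
    StronglyContinuousAt (fun s => -X s) t :=
  fun ψ => (hX ψ).neg

theorem StronglyContinuousAt.const_smul (hX : StronglyContinuousAt X t) (c : ℂ) :
    StronglyContinuousAt (fun s => c • X s) t :=
  fun ψ => (hX ψ).const_smul c

theorem stronglyContinuousAt_const : StronglyContinuousAt (fun _ => A) t :=
  fun _ => continuousAt_const

theorem HasStrongDerivAt.add (hX : HasStrongDerivAt X A t) (hY : HasStrongDerivAt Y B t) :
    HasStrongDerivAt (fun s => X s + Y s) (A + B) t :=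
  fun ψ => (hX ψ).add (hY ψ)

theorem HasStrongDerivAt.sub (hX : HasStrongDerivAt X A t) (hY : HasStrongDerivAt Y B t) :
    HasStrongDerivAt (fun s => X s - Y s) (A - B) t :=
  fun ψ => (hX ψ).sub (hY ψ)

theorem hasStrongDerivAt_const : HasStrongDerivAt (fun _ => A) 0 t :=
  fun ψ => hasDerivAt_const t (A ψ)

theorem HasStrongDerivAt.mul (hC : ∀ s, ‖X s‖ ≤ C) (hc : StronglyContinuousAt X t)
    (hX : HasStrongDerivAt X A t) (hY : HasStrongDerivAt Y B t) :
    HasStrongDerivAt (fun s => X s * Y s) (A * Y t + X t * B) t := by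
  intro ψ
  have h1 := hasDerivAt_iff_tendsto_slope.1 (hX (Y t ψ))
  have h2 := hasDerivAt_iff_tendsto_slope.1 (hY ψ)
  rw [hasDerivAt_iff_tendsto_slope]
  have h3 := tendsto_apply_of_bounded hC ((hc (B ψ)).tendsto.mono_left nhdsWithin_le_nhds) h2
  refine (h1.add h3).congr fun s => ?_
  simp only [slope_def_module, mul_apply_eq_comp, (X s).map_smul_of_tower, map_sub, ← smul_add]
  congr 1
  abel

theorem HasStrongDerivAt.const_mul (hY : HasStrongDerivAt Y B t) (A : E →L[ℂ] E) :
    HasStrongDerivAt (fun s => A * Y s) (A * B) t := by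
  simpa using HasStrongDerivAt.mul (fun _ => le_rfl) stronglyContinuousAt_const
    hasStrongDerivAt_const hY

theorem HasStrongDerivAt.mul_const (hX : HasStrongDerivAt X A t) (B : E →L[ℂ] E) :
    HasStrongDerivAt (fun s => X s * B) (A * B) t :=
  fun ψ => hX (B ψ)

theorem HasStrongDerivAt.lie_const (hX : HasStrongDerivAt X A t) (L : E →L[ℂ] E) :
    HasStrongDerivAt (fun s => ⁅L, X s⁆) ⁅L, A⁆ t := by
  simpa only [Ring.lie_def] using (hX.const_mul L).sub (hX.mul_const L)

/-- The strong derivative of the inverse. -/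
theorem HasStrongDerivAt.inverse (hC : ∀ s, ‖Y s‖ ≤ C) (hc : StronglyContinuousAt Y t)
    (h1 : ∀ s, Y s * X s = 1) (h2 : ∀ s, X s * Y s = 1) (hX : HasStrongDerivAt X A t) :
    HasStrongDerivAt Y (-(Y t * A * Y t)) t := by
  intro ψ
  have h3 := hasDerivAt_iff_tendsto_slope.1 (hX (Y t ψ))
  rw [hasDerivAt_iff_tendsto_slope]
  have h4 := tendsto_apply_of_bounded hC
    ((hc (A (Y t ψ))).tendsto.mono_left nhdsWithin_le_nhds) h3
  refine h4.neg.congr fun s => ?_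
  have e1 : Y s (X s (Y t ψ)) = Y t ψ := DFunLike.congr_fun (h1 s) (Y t ψ)
  have e2 : X t (Y t ψ) = ψ := DFunLike.congr_fun (h2 t) ψ
  simp only [slope_def_module, (Y s).map_smul_of_tower, map_sub, e1, e2, ← smul_neg, neg_sub]

end Strong

/-! ### Integrals of functions that are regular off a countable set -/

theorem aestronglyMeasurable_of_continuousAt_off_countable {F : Type*} [NormedAddCommGroup F]
    [SecondCountableTopologyEither ℝ F] {D : Set ℝ}
    (hD : D.Countable) {f : ℝ → F} (hf : ∀ t ∉ D, ContinuousAt f t) :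
    AEStronglyMeasurable f volume := by
  have h : ContinuousOn f Dᶜ := fun t ht => (hf t ht).continuousWithinAt
  have h1 := h.aestronglyMeasurable (μ := volume) hD.measurableSet.compl
  rwa [Measure.restrict_eq_self_of_ae_mem] at h1
  exact measure_eq_zero_iff_ae_notMem.1 (hD.measure_zero volume)

theorem intervalIntegrable_of_bounded {F : Type*} [NormedAddCommGroup F] {T M : ℝ} (hT : 0 ≤ T)
    {f : ℝ → F} (hf : AEStronglyMeasurable f volume) (hM : ∀ t ∈ Icc 0 T, ‖f t‖ ≤ M) :
    IntervalIntegrable f volume 0 T := by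
  rw [intervalIntegrable_iff_integrableOn_Ioc_of_le hT]
  refine Measure.integrableOn_of_bounded (M := M) (by simp) hf ?_
  exact (ae_restrict_iff' measurableSet_Ioc).2
    (Eventually.of_forall fun t ht => hM t (Ioc_subset_Icc_self ht))

/-! ### Regular families of confined operators -/

/-- A bounded family of operators, strongly continuous off `D`, and local in the sense of
`IsLocal`. -/
structure IsConfined (D : Set ℝ) (T : ℝ) (a b : ℕ) (X : ℝ → Op N) : Prop where
  bounded : ∃ C, ∀ t, ‖X t‖ ≤ C
  continuousAt : ∀ t ∉ D, StronglyContinuousAt X t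
  isLocal : IsLocal T a b X

namespace IsConfined

variable {D D' : Set ℝ} {T : ℝ} {a b a' b' : ℕ} {X Y : ℝ → Op N}

theorem mono (hX : IsConfined D T a b X) (ha : a' ≤ a) (hb : b' ≤ b) : IsConfined D T a' b' X :=
  ⟨hX.bounded, hX.continuousAt, hX.isLocal.mono ha hb⟩

theorem mono_set (hX : IsConfined D T a b X) (hD : D ⊆ D') : IsConfined D' T a b X :=
  ⟨hX.bounded, fun t ht => hX.continuousAt t fun h => ht (hD h), hX.isLocal⟩

theorem of_empty (hX : IsConfined ∅ T a b X) : IsConfined D T a b X :=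
  hX.mono_set (empty_subset D)

theorem neg (hX : IsConfined D T a b X) : IsConfined D T a b (fun t => -X t) :=
  ⟨by simpa using hX.bounded, fun t ht => (hX.continuousAt t ht).neg, hX.isLocal.neg⟩

theorem add (hX : IsConfined D T a b X) (hY : IsConfined D T a b Y) :
    IsConfined D T a b (fun t => X t + Y t) := by
  obtain ⟨C, hC⟩ := hX.bounded
  obtain ⟨C', hC'⟩ := hY.bounded
  exact ⟨⟨C + C', fun t => (norm_add_le _ _).trans (add_le_add (hC t) (hC' t))⟩,
    fun t ht => (hX.continuousAt t ht).add (hY.continuousAt t ht), hX.isLocal.add hY.isLocal⟩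

theorem sub (hX : IsConfined D T a b X) (hY : IsConfined D T a b Y) :
    IsConfined D T a b (fun t => X t - Y t) := by
  simpa only [sub_eq_add_neg] using hX.add hY.neg

theorem smul (hX : IsConfined D T a b X) (c : ℂ) : IsConfined D T a b (fun t => c • X t) := by
  obtain ⟨C, hC⟩ := hX.bounded
  refine ⟨⟨‖c‖ * C, fun t => ?_⟩, fun t ht => (hX.continuousAt t ht).const_smul c,
    hX.isLocal.smul c⟩
  rw [norm_smul]
  exact mul_le_mul_of_nonneg_left (hC t) (norm_nonneg c)

theorem mul (hX : IsConfined D T a b X) (hY : IsConfined D T a' b' Y) :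
    IsConfined D T (a + a') (b + b') (fun t => X t * Y t) := by
  obtain ⟨C, hC⟩ := hX.bounded
  obtain ⟨C', hC'⟩ := hY.bounded
  exact ⟨⟨C * C', fun t => (norm_mul_le _ _).trans
      (mul_le_mul (hC t) (hC' t) (norm_nonneg _) ((norm_nonneg _).trans (hC t)))⟩,
    fun t ht => (hX.continuousAt t ht).mul hC (hY.continuousAt t ht), hX.isLocal.mul hY.isLocal⟩

theorem lie (hX : IsConfined D T a b X) (hY : IsConfined D T a' b' Y) :
    IsConfined D T (a + a') (b + b') (fun t => ⁅X t, Y t⁆) :=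
  (hX.mul hY).sub ((hY.mul hX).mono (add_comm a a').le (add_comm b b').le)

theorem lie_of_isLocal (hX : IsConfined D T a b X) {L : Op N}
    (hL : IsLocal T a' b' (fun t => ⁅L, X t⁆)) : IsConfined D T a' b' (fun t => ⁅L, X t⁆) := by
  obtain ⟨C, hC⟩ := hX.bounded
  refine ⟨⟨‖L‖ * C + C * ‖L‖, fun t => ?_⟩, fun t ht => ?_, hL⟩
  · rw [Ring.lie_def]
    refine (norm_sub_le _ _).trans (add_le_add ((norm_mul_le _ _).trans ?_)
      ((norm_mul_le _ _).trans ?_)) <;> gcongr <;> exact hC t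
  · have hc := hX.continuousAt t ht
    simpa only [Ring.lie_def, sub_eq_add_neg] using
      (StronglyContinuousAt.mul (fun _ => le_rfl) stronglyContinuousAt_const hc).add
        (hc.mul hC stronglyContinuousAt_const).neg

theorem lie_op₁ (hX : IsConfined D T a b X) (Λ : SwitchFunction) :
    IsConfined D T (a + 1) b (fun t => ⁅Λ.op₁ N, X t⁆) :=
  hX.lie_of_isLocal (hX.isLocal.lie_op₁ Λ)

theorem lie_op₂ (hX : IsConfined D T a b X) (Λ : SwitchFunction) :
    IsConfined D T a (b + 1) (fun t => ⁅Λ.op₂ N, X t⁆) :=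
  hX.lie_of_isLocal (hX.isLocal.lie_op₂ Λ)

theorem continuousAt_entry (hX : IsConfined D T a b X) {t : ℝ} (ht : t ∉ D) (p q : Site N) :
    ContinuousAt (fun s => entry (X s) p q) t :=
  Tendsto.inner tendsto_const_nhds (hX.continuousAt t ht _)

theorem intervalIntegrable_trace (hX : IsConfined D T 1 1 X) (hD : D.Countable) (hT : 0 ≤ T) :
    IntervalIntegrable (fun t => trace (X t)) volume 0 T := by
  obtain ⟨f, hf, hXf⟩ := hX.isLocal.exists_summable
  have hf' : Summable fun p : Site N => f (p, p) :=
    hf.comp_injective (i := fun p : Site N => (p, p)) fun _ _ h => (Prod.ext_iff.1 h).1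
  have hm : AEStronglyMeasurable (fun t => trace (X t)) (volume.restrict (Ioc 0 T)) := by
    refine aestronglyMeasurable_of_tendsto_ae (u := (atTop : Filter (Finset (Site N))))
      (f := fun F t => ∑ p ∈ F, entry (X t) p p) (fun F => ?_) ?_
    · exact (aestronglyMeasurable_of_continuousAt_off_countable hD fun t ht =>
        tendsto_finsetSum F fun p _ => hX.continuousAt_entry ht p p).restrict
    · refine (ae_restrict_iff' measurableSet_Ioc).2 (Eventually.of_forall fun t ht => ?_)
      exact (hX.isLocal.summable_diag (Ioc_subset_Icc_self ht)).hasSum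
  rw [intervalIntegrable_iff_integrableOn_Ioc_of_le hT]
  refine IntegrableOn.of_bound (by simp) hm (∑' p, f (p, p)) ?_
  refine (ae_restrict_iff' measurableSet_Ioc).2 (Eventually.of_forall fun t ht => ?_)
  exact tsum_of_norm_bounded hf'.hasSum fun p => hXf t (Ioc_subset_Icc_self ht) p p

/-- The fundamental theorem of calculus under the trace. -/
theorem integral_trace_deriv {X' : ℝ → Op N} (hX : IsConfined ∅ T 1 1 X)
    (hX' : IsConfined D T 1 1 X') (hD : D.Countable) (hT : 0 ≤ T)
    (h : ∀ t ∉ D, HasStrongDerivAt X (X' t) t) :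
    ∫ t in (0 : ℝ)..T, trace (X' t) = trace (X T) - trace (X 0) := by
  obtain ⟨f, hf, hXf⟩ := hX'.isLocal.exists_summable
  have hf' : Summable fun p : Site N => f (p, p) :=
    hf.comp_injective (i := fun p : Site N => (p, p)) fun _ _ h => (Prod.ext_iff.1 h).1
  have hm : ∀ p : Site N, AEStronglyMeasurable (fun t => entry (X' t) p p) volume := fun p =>
    aestronglyMeasurable_of_continuousAt_off_countable hD fun t ht => hX'.continuousAt_entry ht p p
  have h1 : ∀ p : Site N, ∫ t in (0 : ℝ)..T, entry (X' t) p p =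
      entry (X T) p p - entry (X 0) p p := fun p => by
    refine integral_eq_of_hasDerivAt_off_countable (fun t => entry (X t) p p) _ hD
      (fun t _ => (hX.continuousAt_entry (notMem_empty t) p p).continuousWithinAt)
      (fun t ht => ?_) (intervalIntegrable_of_bounded hT (hm p) fun t ht => hXf t ht p p)
    simpa [entry] using (hasDerivAt_const t (siteVec p)).inner ℂ (h t ht.2 (siteVec p))
  -- The exponential bounds give a summable majorant of the diagonal entries, uniform in time, so
  -- the sum over sites and the time integral may be exchanged.
  have h2 := intervalIntegral.hasSum_integral_of_dominated_convergence (μ := volume) (a := 0)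
    (b := T) (F := fun (p : Site N) t => entry (X' t) p p) (f := fun t => trace (X' t))
    (fun p _ => f (p, p)) (fun p => (hm p).restrict)
    (fun p => Eventually.of_forall fun t ht => hXf t
      (by rw [uIoc_of_le hT] at ht; exact Ioc_subset_Icc_self ht) p p)
    (Eventually.of_forall fun _ _ => hf') intervalIntegrable_const
    (Eventually.of_forall fun t ht => (hX'.isLocal.summable_diag
      (by rw [uIoc_of_le hT] at ht; exact Ioc_subset_Icc_self ht)).hasSum)
  simp only [h1] at h2
  refine h2.unique ?_
  exact (hX.isLocal.summable_diag (right_mem_Icc.2 hT)).hasSum.sub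
    (hX.isLocal.summable_diag (left_mem_Icc.2 hT)).hasSum

end IsConfined

/-! ### Traceless families -/

/-- A family of operators confined in both directions whose traces vanish. -/
structure IsTraceless (T : ℝ) (X : ℝ → Op N) : Prop where
  isLocal : IsLocal T 1 1 X
  trace_eq_zero : ∀ t ∈ Icc 0 T, trace (X t) = 0

namespace IsTraceless

variable {D : Set ℝ} {T : ℝ} {a b a' b' : ℕ} {X Y : ℝ → Op N}

theorem add (hX : IsTraceless T X) (hY : IsTraceless T Y) :
    IsTraceless T (fun t => X t + Y t) :=
  ⟨hX.isLocal.add hY.isLocal, fun t ht => by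
    rw [hX.isLocal.trace_add hY.isLocal ht, hX.trace_eq_zero t ht, hY.trace_eq_zero t ht, add_zero]⟩

theorem sub (hX : IsTraceless T X) (hY : IsTraceless T Y) :
    IsTraceless T (fun t => X t - Y t) :=
  ⟨hX.isLocal.sub hY.isLocal, fun t ht => by
    rw [hX.isLocal.trace_sub hY.isLocal ht, hX.trace_eq_zero t ht, hY.trace_eq_zero t ht, sub_zero]⟩

end IsTraceless

theorem IsLocal.isTraceless_of {T : ℝ} {X : ℝ → Op N} (hX : IsLocal T 1 1 X)
    (h : ∀ t, trace (X t) = 0) : IsTraceless T X :=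
  ⟨hX, fun t _ => h t⟩

theorem IsConfined.isTraceless_lie {D : Set ℝ} {T : ℝ} {a b a' b' : ℕ} {X Y : ℝ → Op N}
    (hX : IsConfined D T a b X) (hY : IsConfined D T a' b' Y)
    (ha : 1 ≤ a + a') (hb : 1 ≤ b + b') : IsTraceless T (fun t => ⁅X t, Y t⁆) := by
  refine ⟨((hX.lie hY).mono ha hb).isLocal, fun t ht => ?_⟩
  rw [Ring.lie_def, ((hX.mul hY).mono ha hb).isLocal.trace_sub
    ((hY.mul hX).mono (by omega) (by omega)).isLocal ht,
    hX.isLocal.trace_mul_comm hY.isLocal ha hb ht, sub_self]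

/-! ### Algebraic identities behind the trace formulas -/

section Ring

variable {R : Type*} [Ring R]

/-- Zero curvature of the left logarithmic derivative in the two switch directions. The last term
disappears for commuting `x` and `y`. The right-handed version differs in the sign of the quadratic
term. -/
theorem ring_lie_left_sub {w u x y : R} (hwu : w * u = 1) (huw : u * w = 1) :
    ⁅x, w * ⁅y, u⁆⁆ - ⁅y, w * ⁅x, u⁆⁆ = -⁅w * ⁅x, u⁆, w * ⁅y, u⁆⁆ + w * ⁅⁅x, y⁆, u⁆ := by
  have h : ∀ z : R, w * (u * z) = z := fun z => by rw [← mul_assoc, hwu, one_mul]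
  have h' : ∀ z : R, u * (w * z) = z := fun z => by rw [← mul_assoc, huw, one_mul]
  simp only [Ring.lie_def, mul_sub, sub_mul, mul_assoc, h, h']
  abel

theorem ring_lie_right_sub {w u x y : R} (hwu : w * u = 1) (huw : u * w = 1) :
    ⁅x, ⁅y, u⁆ * w⁆ - ⁅y, ⁅x, u⁆ * w⁆ = ⁅⁅x, u⁆ * w, ⁅y, u⁆ * w⁆ + ⁅⁅x, y⁆, u⁆ * w := by
  have h : ∀ z : R, w * (u * z) = z := fun z => by rw [← mul_assoc, hwu, one_mul]
  simp only [Ring.lie_def, mul_sub, sub_mul, mul_assoc, h, huw, mul_one]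
  abel

/-- Zero curvature between time and a switch direction: with `d` the time derivative of `u`, the
left side is the product rule for `w * ⁅x, u⁆`. -/
theorem ring_left_deriv {w u d x : R} (hwu : w * u = 1) (huw : u * w = 1) :
    -(w * d * w) * ⁅x, u⁆ + w * ⁅x, d⁆ = ⁅x, w * d⁆ - ⁅w * d, w * ⁅x, u⁆⁆ := by
  have h : ∀ z : R, w * (u * z) = z := fun z => by rw [← mul_assoc, hwu, one_mul]
  have h' : ∀ z : R, u * (w * z) = z := fun z => by rw [← mul_assoc, huw, one_mul]
  simp only [Ring.lie_def, mul_sub, sub_mul, mul_assoc, neg_mul, h, h']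
  abel

theorem ring_right_deriv {w u d x : R} (hwu : w * u = 1) (huw : u * w = 1) :
    ⁅x, d⁆ * w + ⁅x, u⁆ * -(w * d * w) = ⁅x, d * w⁆ + ⁅d * w, ⁅x, u⁆ * w⁆ := by
  have h : ∀ z : R, w * (u * z) = z := fun z => by rw [← mul_assoc, hwu, one_mul]
  have h' : ∀ z : R, u * (w * z) = z := fun z => by rw [← mul_assoc, huw, one_mul]
  simp only [Ring.lie_def, mul_sub, sub_mul, mul_assoc, mul_neg, h, h', huw, mul_one]
  abel

/-- The second line is the time derivative of `A₁ * B₂ - A₂ * B₁`. Modulo commutators, shifting `⁅x,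
·⁆` and `⁅y, ·⁆` from one factor to the other turns its linear terms, by `hB` and `hA`, into `-At *
⁅B₁, B₂⁆ - Bt * ⁅A₁, A₂⁆`. Its quadratic terms cancel the remaining mixed terms by cyclicity. -/
theorem ring_mixed_terms {x y At A₁ A₂ Bt B₁ B₂ : R}
    (hA : ⁅x, A₂⁆ - ⁅y, A₁⁆ = -⁅A₁, A₂⁆) (hB : ⁅x, B₂⁆ - ⁅y, B₁⁆ = ⁅B₁, B₂⁆) :
    (At + Bt) * ⁅A₁ + B₁, A₂ + B₂⁆ - At * ⁅A₁, A₂⁆ - Bt * ⁅B₁, B₂⁆ +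
      ((⁅x, At⁆ - ⁅At, A₁⁆) * B₂ + A₁ * (⁅y, Bt⁆ + ⁅Bt, B₂⁆) -
        ((⁅y, At⁆ - ⁅At, A₂⁆) * B₁ + A₂ * (⁅x, Bt⁆ + ⁅Bt, B₁⁆))) =
      ⁅x, At * B₂ - A₂ * Bt⁆ - ⁅y, At * B₁ - A₁ * Bt⁆ +
      (⁅A₁, At * B₂⁆ + ⁅At * B₁, A₂⁆ + ⁅Bt, ⁅A₁, A₂⁆⁆ + ⁅Bt, A₁ * B₂⁆ + ⁅A₁, Bt * B₂⁆ +
        ⁅Bt * B₁, A₂⁆ - ⁅Bt, A₂ * B₁⁆) := by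
  have h1 : ⁅A₁, A₂⁆ = ⁅y, A₁⁆ - ⁅x, A₂⁆ := by rw [← neg_sub, hA, neg_neg]
  have e1 : (A₁ * A₂ - A₂ * A₁) * Bt = ((y * A₁ - A₁ * y) - (x * A₂ - A₂ * x)) * Bt := by
    simpa only [Ring.lie_def] using congrArg (· * Bt) h1
  have e2 : At * ((x * B₂ - B₂ * x) - (y * B₁ - B₁ * y)) = At * (B₁ * B₂ - B₂ * B₁) := by
    simpa only [Ring.lie_def] using congrArg (At * ·) hB
  simp only [Ring.lie_def]
  have e1' := sub_eq_zero.2 e1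
  have e2' := sub_eq_zero.2 e2
  rw [← sub_eq_zero]
  -- The difference of the two sides is exactly one instance of `hA` multiplied by `Bt` on the right
  -- and one of `hB` multiplied by `At` on the left.
  calc _ = ((A₁ * A₂ - A₂ * A₁) * Bt - ((y * A₁ - A₁ * y) - (x * A₂ - A₂ * x)) * Bt) -
        (At * ((x * B₂ - B₂ * x) - (y * B₁ - B₁ * y)) - At * (B₁ * B₂ - B₂ * B₁)) := by noncomm_ring
    _ = 0 := by rw [e1', e2', sub_zero]

/-- The intertwining relations turn `At * w * δ * u * A` into `w * (Bt * δ * B * u)`, which is `Bt *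
δ * B` up to a commutator with `w`. All terms then pair into commutators, and `⁅x, ·⁆` passes
through `δ` by `hδ`. -/
theorem ring_switch_difference {x δ At A Bt B w u : R} (huw : u * w = 1)
    (hA : u * A = B * u) (hA' : A * w = w * B) (hAt : At * w = w * Bt) (hδ : δ * x = x * δ) :
    At * ⁅w * δ * u - δ, A⁆ + δ * ((⁅x, At⁆ - ⁅At, A⁆) + (⁅x, Bt⁆ + ⁅Bt, B⁆)) =
      ⁅w, Bt * δ * B * u⁆ + ⁅Bt, δ * B⁆ - ⁅w, Bt * B * δ * u⁆ - ⁅Bt * B, δ⁆ - ⁅At, δ * A⁆ +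
        ⁅At * A, δ⁆ + ⁅x, δ * (At + Bt)⁆ := by
  have h1 : ∀ z : R, At * (w * z) = w * (Bt * z) := fun z => by
    rw [← mul_assoc, hAt, mul_assoc]
  have h2 : ∀ z : R, A * (w * z) = w * (B * z) := fun z => by
    rw [← mul_assoc, hA', mul_assoc]
  have h3 : ∀ z : R, x * (δ * z) = δ * (x * z) := fun z => by
    rw [← mul_assoc, ← hδ, mul_assoc]
  simp only [Ring.lie_def, mul_sub, sub_mul, mul_add, add_mul, mul_assoc, huw, mul_one, hA, h1,
    h2, h3]
  abel

end Ring

/-! ### Smooth families of local unitary operators -/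

/-- A strongly continuous family of local unitary operators with strong derivative `du` off `D`. -/
structure IsSmoothFamily (D : Set ℝ) (T : ℝ) (u du : ℝ → Op N) : Prop where
  mem_unitary : ∀ t, u t ∈ unitary (Op N)
  confined : IsConfined ∅ T 0 0 u
  confined_star : IsConfined ∅ T 0 0 (fun t => star (u t))
  confined_deriv : IsConfined D T 0 0 du
  hasDeriv : ∀ t ∉ D, HasStrongDerivAt u (du t) t

namespace IsSmoothFamily

variable {D : Set ℝ} {T : ℝ} {u du v dv : ℝ → Op N}

theorem star_mul_self (h : IsSmoothFamily D T u du) (t : ℝ) : star (u t) * u t = 1 :=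
  (Unitary.mem_iff.1 (h.mem_unitary t)).1

theorem mul_star_self (h : IsSmoothFamily D T u du) (t : ℝ) : u t * star (u t) = 1 :=
  (Unitary.mem_iff.1 (h.mem_unitary t)).2

theorem mul (hu : IsSmoothFamily D T u du) (hv : IsSmoothFamily D T v dv) :
    IsSmoothFamily D T (fun t => u t * v t) (fun t => du t * v t + u t * dv t) where
  mem_unitary t := mul_mem (hu.mem_unitary t) (hv.mem_unitary t)
  confined := hu.confined.mul hv.confined
  confined_star := by simpa only [star_mul] using hv.confined_star.mul hu.confined_star
  confined_deriv := (hu.confined_deriv.mul hv.confined.of_empty).add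
    (hu.confined.of_empty.mul hv.confined_deriv)
  hasDeriv t ht := by
    obtain ⟨C, hC⟩ := hu.confined.bounded
    exact HasStrongDerivAt.mul hC (hu.confined.continuousAt t (notMem_empty t)) (hu.hasDeriv t ht)
      (hv.hasDeriv t ht)

theorem hasStrongDerivAt_star (h : IsSmoothFamily D T u du) {t : ℝ} (ht : t ∉ D) :
    HasStrongDerivAt (fun s => star (u s)) (-(star (u t) * du t * star (u t))) t := by
  obtain ⟨C, hC⟩ := h.confined_star.bounded
  exact HasStrongDerivAt.inverse hC (h.confined_star.continuousAt t (notMem_empty t))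
    h.star_mul_self h.mul_star_self (h.hasDeriv t ht)

theorem hasStrongDerivAt_left (h : IsSmoothFamily D T u du) {t : ℝ} (ht : t ∉ D) (L : Op N) :
    HasStrongDerivAt (fun s => star (u s) * ⁅L, u s⁆)
      (⁅L, star (u t) * du t⁆ - ⁅star (u t) * du t, star (u t) * ⁅L, u t⁆⁆) t := by
  obtain ⟨C, hC⟩ := h.confined_star.bounded
  rw [← ring_left_deriv (h.star_mul_self t) (h.mul_star_self t)]
  exact HasStrongDerivAt.mul hC (h.confined_star.continuousAt t (notMem_empty t))
    (h.hasStrongDerivAt_star ht) ((h.hasDeriv t ht).lie_const L)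

theorem hasStrongDerivAt_right (h : IsSmoothFamily D T u du) {t : ℝ} (ht : t ∉ D) (L : Op N)
    {C : ℝ} (hC : ∀ s, ‖⁅L, u s⁆‖ ≤ C) (hc : StronglyContinuousAt (fun s => ⁅L, u s⁆) t) :
    HasStrongDerivAt (fun s => ⁅L, u s⁆ * star (u s))
      (⁅L, du t * star (u t)⁆ + ⁅du t * star (u t), ⁅L, u t⁆ * star (u t)⁆) t := by
  rw [← ring_right_deriv (h.star_mul_self t) (h.mul_star_self t)]
  exact HasStrongDerivAt.mul hC hc ((h.hasDeriv t ht).lie_const L) (h.hasStrongDerivAt_star ht)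

/-- The operator under the trace, with the derivative `du`. -/
def density (u du : ℝ → Op N) (L₁ L₂ : Op N) (t : ℝ) : Op N :=
  star (u t) * du t * ⁅star (u t) * ⁅L₁, u t⁆, star (u t) * ⁅L₂, u t⁆⁆

theorem density_swap (L₁ L₂ : Op N) (t : ℝ) : density u du L₁ L₂ t = -density u du L₂ L₁ t := by
  have (x y : Op N) : ⁅x, y⁆ = -⁅y, x⁆ := by rw [Ring.lie_def, Ring.lie_def, neg_sub]
  rw [density, density, this, mul_neg]

theorem indexOperator_eq (h : IsSmoothFamily D T u du) (Λ₁ Λ₂ : SwitchFunction) {t : ℝ}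
    (ht : t ∉ D) : indexOperator Λ₁ Λ₂ u t = density u du (Λ₁.op₁ N) (Λ₂.op₂ N) t := by
  rw [indexOperator, density, (h.hasDeriv t ht).strongDeriv_eq]

theorem confined_density (h : IsSmoothFamily D T u du) (Λ₁ Λ₂ : SwitchFunction) :
    IsConfined D T 1 1 (density u du (Λ₁.op₁ N) (Λ₂.op₂ N)) := by
  have hw := h.confined_star.of_empty (D := D)
  have hu := h.confined.of_empty (D := D)
  exact ((hw.mul h.confined_deriv).mul
    ((hw.mul (hu.lie_op₁ Λ₁)).lie (hw.mul (hu.lie_op₂ Λ₂)))).mono (by simp) (by simp)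

theorem ae_notMem (hD : D.Countable) : ∀ᵐ t ∂(volume : Measure ℝ), t ∉ D :=
  measure_eq_zero_iff_ae_notMem.1 (hD.measure_zero volume)

theorem ae_indexOperator (h : IsSmoothFamily D T u du) (hD : D.Countable)
    (Λ₁ Λ₂ : SwitchFunction) :
    (fun t => trace (indexOperator Λ₁ Λ₂ u t)) =ᵐ[volume]
      fun t => trace (density u du (Λ₁.op₁ N) (Λ₂.op₂ N) t) :=
  (ae_notMem hD).mono fun t ht => by simp only [h.indexOperator_eq Λ₁ Λ₂ ht]

theorem indexIntegral_eq (h : IsSmoothFamily D T u du) (hD : D.Countable)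
    (Λ₁ Λ₂ : SwitchFunction) : indexIntegral T Λ₁ Λ₂ u =
      (1 / 2 : ℂ) * ∫ t in (0 : ℝ)..T, trace (density u du (Λ₁.op₁ N) (Λ₂.op₂ N) t) := by
  rw [indexIntegral]
  congr 1
  exact intervalIntegral.integral_congr_ae
    ((h.ae_indexOperator hD Λ₁ Λ₂).mono fun t ht _ => ht)

theorem hasBulkIndex (h : IsSmoothFamily D T u du) (hD : D.Countable) (hT : 0 ≤ T) {c : ℂ}
    (hc : ∀ Λ₁ Λ₂, indexIntegral T Λ₁ Λ₂ u = c) : HasBulkIndex T u c := by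
  refine fun Λ₁ Λ₂ => ⟨?_, ?_, hc Λ₁ Λ₂⟩
  · refine (ae_restrict_iff' measurableSet_Icc).2 ((ae_notMem hD).mono fun t ht htT => ?_)
    refine ⟨⟨_, h.hasDeriv t ht⟩, ?_⟩
    rw [h.indexOperator_eq Λ₁ Λ₂ ht]
    exact (h.confined_density Λ₁ Λ₂).isLocal.isTraceClass htT
  · refine ((h.confined_density Λ₁ Λ₂).intervalIntegrable_trace hD hT).congr_ae ?_
    exact ae_restrict_of_ae (h.ae_indexOperator hD Λ₁ Λ₂).symm

/-! ### Independence of the switch functions -/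

/-- Stated for an abstract pair `L`, `δ` so that both directions are covered: `δ` is confined along
one axis and commutators with `L` along the other. The integrand is minus the derivative of the
trace of `δ * (A + B)`, up to traceless terms. -/
theorem integral_trace_switch_difference (h : IsSmoothFamily D T u du) (hD : D.Countable)
    (hT : 0 ≤ T) (h0 : u 0 = 1) (h1 : u T = 1) {i j : ℕ} (hij : 1 ≤ i + j) {L δ : Op N}
    (hL : ∀ {D : Set ℝ} {a b : ℕ} {X : ℝ → Op N}, IsConfined D T a b X →
      IsConfined D T (a + j) (b + i) (fun t => ⁅L, X t⁆))
    (hL0 : ∀ X : Op N, trace ⁅L, X⁆ = 0) (hδ : IsConfined ∅ T i j (fun _ => δ))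
    (hδL : δ * L = L * δ) :
    ∫ t in (0 : ℝ)..T, trace (star (u t) * du t *
      ⁅star (u t) * δ * u t - δ, star (u t) * ⁅L, u t⁆⁆) = 0 := by
  have hji : 1 ≤ j + i := by omega
  have hu := h.confined
  have hw := h.confined_star
  have huD := hu.of_empty (D := D)
  have hwD := hw.of_empty (D := D)
  have hδD := hδ.of_empty (D := D)
  have hA := hw.mul (hL hu)
  have hB := (hL hu).mul hw
  have hAD := hA.of_empty (D := D)
  have hBD := hB.of_empty (D := D)
  have hAt := hwD.mul h.confined_deriv
  have hBt := h.confined_deriv.mul hwD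
  have hdA := (hL hAt).sub ((hAt.lie hAD).mono (by simp) (by simp))
  have hdB := (hL hBt).add ((hBt.lie hBD).mono (by simp) (by simp))
  have hF := (hδ.mul (hA.add (hB.mono (by simp) (by simp)))).mono (a' := 1) (b' := 1)
    (by simpa using hij) (by simpa using hji)
  have hF' := (hδD.mul (hdA.add hdB)).mono (a' := 1) (b' := 1)
    (by simpa using hij) (by simpa using hji)
  have hderiv : ∀ t ∉ D, HasStrongDerivAt _ _ t := fun t ht => by
    obtain ⟨C, hC⟩ := (hL hu).bounded
    exact ((h.hasStrongDerivAt_left ht L).add (h.hasStrongDerivAt_right ht L hC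
      ((hL hu).continuousAt t (notMem_empty t)))).const_mul δ
  have hint := hF.integral_trace_deriv hF' hD hT hderiv
  have hzero : ∀ A : Op N, ⁅A, (1 : Op N)⁆ = 0 := fun A => by rw [Ring.lie_def]; simp
  simp only [h0, h1, hzero, mul_zero, zero_mul, add_zero, sub_self] at hint
  -- The summands follow the right side of `ring_switch_difference`. In the last one `δ * (At + Bt)`
  -- is confined along one axis only, so cyclicity is not available and the vanishing diagonal `hL0`
  -- is used instead.
  have hsum := (((((((hwD.isTraceless_lie (((hBt.mul hδD).mul hBD).mul huD) (by simpa using hij)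
      (by simpa using hji)).add
    (hBt.isTraceless_lie (hδD.mul hBD) (by simpa using hij) (by simpa using hji))).sub
    (hwD.isTraceless_lie (((hBt.mul hBD).mul hδD).mul huD) (by simpa using hji)
      (by simpa using hij))).sub
    ((hBt.mul hBD).isTraceless_lie hδD (by simpa using hji) (by simpa using hij))).sub
    (hAt.isTraceless_lie (hδD.mul hAD) (by simpa using hij) (by simpa using hji))).add
    ((hAt.mul hAD).isTraceless_lie hδD (by simpa using hji) (by simpa using hij))).add
    ⟨((hL (hδD.mul (hAt.add hBt))).mono (by simpa using hij) (by simpa using hji)).isLocal,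
      fun t _ => hL0 _⟩)
  rw [← neg_eq_zero, ← intervalIntegral.integral_neg, ← hint]
  refine intervalIntegral.integral_congr fun t ht => ?_
  rw [uIcc_of_le hT] at ht
  have hwu := h.star_mul_self t
  have huw := h.mul_star_self t
  have hmain := ring_switch_difference (x := L) (δ := δ) (At := star (u t) * du t)
    (A := star (u t) * ⁅L, u t⁆) (Bt := du t * star (u t)) (B := ⁅L, u t⁆ * star (u t))
    (w := star (u t)) (u := u t) huw
    (by rw [← mul_assoc, huw, one_mul, mul_assoc, hwu, mul_one]) (by rw [mul_assoc])
    (by rw [mul_assoc]) hδL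
  have htr := hsum.trace_eq_zero t ht
  have hs := hsum.isLocal.trace_sub hF'.isLocal ht
  rw [htr, zero_sub] at hs
  have := (congrArg trace (eq_sub_of_add_eq hmain)).trans hs
  exact neg_eq_iff_eq_neg.2 this

theorem lie_left_sub (h : IsSmoothFamily D T u du) (L L' : Op N) (t : ℝ) :
    star (u t) * ⁅L, u t⁆ - star (u t) * ⁅L', u t⁆ =
      star (u t) * (L - L') * u t - (L - L') := by
  have := h.star_mul_self t
  simp only [Ring.lie_def, mul_sub, sub_mul, ← mul_assoc, this, one_mul]
  abel

end IsSmoothFamily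

theorem op_mul_op_comm (Λ Λ' : SwitchFunction) (c c' : ℤ × ℤ → ℤ) :
    Λ.op N c * Λ'.op N c' = Λ'.op N c' * Λ.op N c := by
  ext1 ψ
  refine ext_inner_siteVec fun p => ?_
  simp only [mul_apply_eq_comp, inner_siteVec_op]
  ring

/-- Removes the conjugation by `v`, present in the densities of the product and of `v`, at the price
of two commutators with `z`. -/
theorem ring_conjugation {R : Type*} [Ring R] {Q Q₁ Q₂ P S z v : R}
    (h : Q - Q₁ - Q₂ + P = S) (hvz : v * z = 1) :
    z * (Q * v) - (Q₁ + z * (Q₂ * v)) = S + ⁅z, Q * v⁆ - ⁅z, Q₂ * v⁆ - P := by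
  simp only [← h, Ring.lie_def, mul_assoc, hvz, mul_one]
  abel

namespace IsSmoothFamily

variable {D : Set ℝ} {T : ℝ} {u du v dv : ℝ → Op N}

theorem density_sub_left (h : IsSmoothFamily D T u du) (L L' M : Op N) (t : ℝ) :
    density u du L M t - density u du L' M t = star (u t) * du t *
      ⁅star (u t) * (L - L') * u t - (L - L'), star (u t) * ⁅M, u t⁆⁆ := by
  rw [← h.lie_left_sub, density, density, ← mul_sub]
  simp only [Ring.lie_def]
  noncomm_ring

theorem integral_density_congr_left (h : IsSmoothFamily D T u du) (hD : D.Countable)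
    (hT : 0 ≤ T) (h0 : u 0 = 1) (h1 : u T = 1) (Λ₁ Λ₁' Λ₂ : SwitchFunction) :
    ∫ t in (0 : ℝ)..T, trace (density u du (Λ₁.op₁ N) (Λ₂.op₂ N) t) =
      ∫ t in (0 : ℝ)..T, trace (density u du (Λ₁'.op₁ N) (Λ₂.op₂ N) t) := by
  have c := h.confined_density Λ₁ Λ₂
  have c' := h.confined_density Λ₁' Λ₂
  rw [← sub_eq_zero, ← intervalIntegral.integral_sub (c.intervalIntegrable_trace hD hT)
    (c'.intervalIntegrable_trace hD hT),
    ← h.integral_trace_switch_difference (i := 1) (j := 0) hD hT h0 h1 le_rfl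
      (L := Λ₂.op₂ N) (δ := Λ₁.op₁ N - Λ₁'.op₁ N) (fun hX => hX.lie_op₂ Λ₂) (trace_lie_op Λ₂ _)
      ⟨⟨_, fun _ => le_rfl⟩, fun _ _ => stronglyContinuousAt_const,
        isLocal_op_sub_op Λ₁ Λ₁' Prod.fst 1 0 fun p => by simp⟩
      (by rw [sub_mul, mul_sub, op_mul_op_comm Λ₁, op_mul_op_comm Λ₁'])]
  refine intervalIntegral.integral_congr fun t ht => ?_
  rw [uIcc_of_le hT] at ht
  exact (c.isLocal.trace_sub c'.isLocal ht).symm.trans (congrArg trace (h.density_sub_left _ _ _ t))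

theorem integral_density_congr_right (h : IsSmoothFamily D T u du) (hD : D.Countable)
    (hT : 0 ≤ T) (h0 : u 0 = 1) (h1 : u T = 1) (Λ₁ Λ₂ Λ₂' : SwitchFunction) :
    ∫ t in (0 : ℝ)..T, trace (density u du (Λ₁.op₁ N) (Λ₂.op₂ N) t) =
      ∫ t in (0 : ℝ)..T, trace (density u du (Λ₁.op₁ N) (Λ₂'.op₂ N) t) := by
  have c := h.confined_density Λ₁ Λ₂
  have c' := h.confined_density Λ₁ Λ₂'
  -- Exchanging the two switches flips the sign of the density, hence the swapped sides.
  rw [eq_comm, ← sub_eq_zero, ← intervalIntegral.integral_sub (c'.intervalIntegrable_trace hD hT)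
    (c.intervalIntegrable_trace hD hT),
    ← h.integral_trace_switch_difference (i := 0) (j := 1) hD hT h0 h1 le_rfl
      (L := Λ₁.op₁ N) (δ := Λ₂.op₂ N - Λ₂'.op₂ N) (fun hX => hX.lie_op₁ Λ₁) (trace_lie_op Λ₁ _)
      ⟨⟨_, fun _ => le_rfl⟩, fun _ _ => stronglyContinuousAt_const,
        isLocal_op_sub_op Λ₂ Λ₂' Prod.snd 0 1 fun p => by simp⟩
      (by rw [sub_mul, mul_sub, op_mul_op_comm Λ₂, op_mul_op_comm Λ₂'])]
  refine intervalIntegral.integral_congr fun t ht => ?_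
  rw [uIcc_of_le hT] at ht
  refine (c'.isLocal.trace_sub c.isLocal ht).symm.trans (congrArg trace ?_)
  rw [← h.density_sub_left, density_swap (Λ₁.op₁ N), density_swap (Λ₁.op₁ N)]
  abel

theorem indexIntegral_congr (h : IsSmoothFamily D T u du) (hD : D.Countable)
    (hT : 0 ≤ T) (h0 : u 0 = 1) (h1 : u T = 1) (Λ₁ Λ₂ Λ₁' Λ₂' : SwitchFunction) :
    indexIntegral T Λ₁ Λ₂ u = indexIntegral T Λ₁' Λ₂' u := by
  rw [h.indexIntegral_eq hD, h.indexIntegral_eq hD,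
    h.integral_density_congr_left hD hT h0 h1 Λ₁ Λ₁',
    h.integral_density_congr_right hD hT h0 h1 Λ₁' Λ₂ Λ₂']

/-! ### Additivity -/

/-- Up to conjugation by `v`, the logarithmic derivative of a product is the left one of `u` plus
the right one of `v`. This is why `u` is treated from the left and `v` from the right. -/
theorem density_mul (hu : IsSmoothFamily D T u du) (hv : IsSmoothFamily D T v dv) (L M : Op N)
    (t : ℝ) :
    density (fun t => u t * v t) (fun t => du t * v t + u t * dv t) L M t =
      star (v t) * ((star (u t) * du t + dv t * star (v t)) *
        ⁅star (u t) * ⁅L, u t⁆ + ⁅L, v t⁆ * star (v t),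
          star (u t) * ⁅M, u t⁆ + ⁅M, v t⁆ * star (v t)⁆ * v t) := by
  have h1 : ∀ z, star (u t) * (u t * z) = z := fun z => by
    rw [← mul_assoc, hu.star_mul_self, one_mul]
  have h2 : ∀ z, v t * (star (v t) * z) = z := fun z => by
    rw [← mul_assoc, hv.mul_star_self, one_mul]
  have h3 := hv.star_mul_self t
  have h4 : ∀ X : Op N, star (u t * v t) * ⁅X, u t * v t⁆ =
      star (v t) * (star (u t) * ⁅X, u t⁆ + ⁅X, v t⁆ * star (v t)) * v t := fun X => by
    simp only [Ring.lie_def, star_mul, mul_sub, sub_mul, mul_add, add_mul, mul_assoc, h1, h3,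
      mul_one]
    abel
  have h5 : star (u t * v t) * (du t * v t + u t * dv t) =
      star (v t) * (star (u t) * du t + dv t * star (v t)) * v t := by
    simp only [star_mul, mul_add, add_mul, mul_assoc, h1, h3, mul_one]
  simp only [density]
  rw [h4, h4, h5]
  generalize star (u t) * du t + dv t * star (v t) = x
  generalize star (u t) * ⁅L, u t⁆ + ⁅L, v t⁆ * star (v t) = y
  generalize star (u t) * ⁅M, u t⁆ + ⁅M, v t⁆ * star (v t) = z
  simp only [Ring.lie_def, mul_sub, sub_mul, mul_assoc, h2]

theorem density_eq_right (hv : IsSmoothFamily D T v dv) (L M : Op N) (t : ℝ) :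
    density v dv L M t = star (v t) * (dv t * star (v t) *
      ⁅⁅L, v t⁆ * star (v t), ⁅M, v t⁆ * star (v t)⁆ * v t) := by
  have h2 : ∀ z, v t * (star (v t) * z) = z := fun z => by
    rw [← mul_assoc, hv.mul_star_self, one_mul]
  have h3 := hv.star_mul_self t
  rw [density]
  generalize ⁅L, v t⁆ = y
  generalize ⁅M, v t⁆ = z
  simp only [Ring.lie_def, mul_sub, sub_mul, mul_assoc, h3, mul_one]

-- The integrated Polyakov–Wiegmann formula: the defect of additivity is minus the integral of the
-- derivative of the trace of `A₁ * B₂ - A₂ * B₁`, which vanishes at both ends.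
set_option maxHeartbeats 1000000 in
theorem integral_density_mul (hu : IsSmoothFamily D T u du) (hv : IsSmoothFamily D T v dv)
    (hD : D.Countable) (hT : 0 ≤ T) (hu0 : u 0 = 1) (huT : u T = 1) (hv0 : v 0 = 1) (hvT : v T = 1)
    (Λ₁ Λ₂ : SwitchFunction) :
    ∫ t in (0 : ℝ)..T, trace (density (fun t => u t * v t) (fun t => du t * v t + u t * dv t)
        (Λ₁.op₁ N) (Λ₂.op₂ N) t) =
      (∫ t in (0 : ℝ)..T, trace (density u du (Λ₁.op₁ N) (Λ₂.op₂ N) t)) +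
        ∫ t in (0 : ℝ)..T, trace (density v dv (Λ₁.op₁ N) (Λ₂.op₂ N) t) := by
  have cu := hu.confined_density Λ₁ Λ₂
  have cv := hv.confined_density Λ₁ Λ₂
  have cuv := (hu.mul hv).confined_density Λ₁ Λ₂
  have hw := hu.confined_star
  have hz := hv.confined_star
  have hA₁ := hw.mul (hu.confined.lie_op₁ Λ₁)
  have hA₂ := hw.mul (hu.confined.lie_op₂ Λ₂)
  have hB₁ := (hv.confined.lie_op₁ Λ₁).mul hz
  have hB₂ := (hv.confined.lie_op₂ Λ₂).mul hz
  simp only [Nat.zero_add, Nat.add_zero] at hA₁ hA₂ hB₁ hB₂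
  have hAt := hw.of_empty.mul hu.confined_deriv
  have hBt := hv.confined_deriv.mul hz.of_empty
  simp only [Nat.add_zero] at hAt hBt
  have hA₁D := hA₁.of_empty (D := D)
  have hA₂D := hA₂.of_empty (D := D)
  have hB₁D := hB₁.of_empty (D := D)
  have hB₂D := hB₂.of_empty (D := D)
  have hzD := hz.of_empty (D := D)
  have hvD := hv.confined.of_empty (D := D)
  have hdA₁ := (hAt.lie_op₁ Λ₁).sub ((hAt.lie hA₁D).mono (a' := 0 + 1) (b' := 0) (by simp) (by simp))
  have hdA₂ := (hAt.lie_op₂ Λ₂).sub ((hAt.lie hA₂D).mono (a' := 0) (b' := 0 + 1) (by simp) (by simp))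
  have hdB₁ := (hBt.lie_op₁ Λ₁).add ((hBt.lie hB₁D).mono (a' := 0 + 1) (b' := 0) (by simp) (by simp))
  have hdB₂ := (hBt.lie_op₂ Λ₂).add ((hBt.lie hB₂D).mono (a' := 0) (b' := 0 + 1) (by simp) (by simp))
  have hF := (hA₁.mul hB₂).sub ((hA₂.mul hB₁).mono (by simp) (by simp))
  simp only [Nat.zero_add, Nat.add_zero] at hF hdA₁ hdA₂ hdB₁ hdB₂
  have hF' := ((hdA₁.mul hB₂D).add (hA₁D.mul hdB₂)).sub
    (((hdA₂.mul hB₁D).add (hA₂D.mul hdB₁)).mono (by simp) (by simp))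
  simp only [Nat.zero_add, Nat.add_zero] at hF'
  have hderiv : ∀ t ∉ D, HasStrongDerivAt _ _ t := fun t ht => by
    obtain ⟨C₁, hC₁⟩ := hA₁.bounded
    obtain ⟨C₂, hC₂⟩ := hA₂.bounded
    obtain ⟨C₁', hC₁'⟩ := (hv.confined.lie_op₁ Λ₁).bounded
    obtain ⟨C₂', hC₂'⟩ := (hv.confined.lie_op₂ Λ₂).bounded
    have hB₁' := hv.hasStrongDerivAt_right ht (Λ₁.op₁ N) hC₁'
      ((hv.confined.lie_op₁ Λ₁).continuousAt t (notMem_empty t))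
    have hB₂' := hv.hasStrongDerivAt_right ht (Λ₂.op₂ N) hC₂'
      ((hv.confined.lie_op₂ Λ₂).continuousAt t (notMem_empty t))
    exact (HasStrongDerivAt.mul hC₁ (hA₁.continuousAt t (notMem_empty t))
        (hu.hasStrongDerivAt_left ht (Λ₁.op₁ N)) hB₂').sub
      (HasStrongDerivAt.mul hC₂ (hA₂.continuousAt t (notMem_empty t))
        (hu.hasStrongDerivAt_left ht (Λ₂.op₂ N)) hB₁')
  have hint := hF.integral_trace_deriv hF' hD hT hderiv
  have hzero : ∀ A : Op N, ⁅A, (1 : Op N)⁆ = 0 := fun A => by rw [Ring.lie_def]; simp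
  simp only [hu0, hv0, huT, hvT, hzero, mul_zero, zero_mul, sub_self] at hint
  -- The terms of `ring_mixed_terms`, followed by the two commutators of `ring_conjugation`. The
  -- first two are commutators with the switches themselves and vanish on the diagonal; all others
  -- are traceless by cyclicity.
  have hsum : IsTraceless T _ :=
    ((((((((hAt.mul hB₂D).sub (hA₂D.mul hBt)).lie_op₁ Λ₁).isLocal.isTraceless_of
      fun t => trace_lie_op _ _ _).sub
    ((((hAt.mul hB₁D).sub (hA₁D.mul hBt)).lie_op₂ Λ₂).isLocal.isTraceless_of
      fun t => trace_lie_op _ _ _)).add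
    (((((((hA₁D.isTraceless_lie (hAt.mul hB₂D) le_rfl le_rfl).add
      ((hAt.mul hB₁D).isTraceless_lie hA₂D le_rfl le_rfl)).add
      (hBt.isTraceless_lie (hA₁D.lie hA₂D) le_rfl le_rfl)).add
      (hBt.isTraceless_lie (hA₁D.mul hB₂D) le_rfl le_rfl)).add
      (hA₁D.isTraceless_lie (hBt.mul hB₂D) le_rfl le_rfl)).add
      ((hBt.mul hB₁D).isTraceless_lie hA₂D le_rfl le_rfl)).sub
      (hBt.isTraceless_lie (hA₂D.mul hB₁D) le_rfl le_rfl))).add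
    (hzD.isTraceless_lie (((hAt.add hBt).mul (((hA₁D.mono le_rfl le_rfl).add hB₁D).lie
      (hA₂D.add hB₂D))).mul hvD) le_rfl le_rfl)).sub
    (hzD.isTraceless_lie ((hBt.mul (hB₁D.lie hB₂D)).mul hvD) le_rfl le_rfl))
  rw [← intervalIntegral.integral_add (cu.intervalIntegrable_trace hD hT)
    (cv.intervalIntegrable_trace hD hT), ← sub_eq_zero,
    ← intervalIntegral.integral_sub (cuv.intervalIntegrable_trace hD hT)
      ((cu.intervalIntegrable_trace hD hT).add (cv.intervalIntegrable_trace hD hT)),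
    ← neg_eq_zero, ← intervalIntegral.integral_neg, ← hint]
  refine intervalIntegral.integral_congr fun t ht => ?_
  rw [uIcc_of_le hT] at ht
  have hwu := hu.star_mul_self t
  have huw := hu.mul_star_self t
  have hzv := hv.star_mul_self t
  have hvz := hv.mul_star_self t
  have hLM : ⁅Λ₁.op₁ N, Λ₂.op₂ N⁆ = 0 := by rw [Ring.lie_def, op_mul_op_comm, sub_self]
  have hzero' : ∀ A : Op N, ⁅(0 : Op N), A⁆ = 0 := fun A => by rw [Ring.lie_def]; simp
  have rA := ring_lie_left_sub (x := Λ₁.op₁ N) (y := Λ₂.op₂ N) hwu huw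
  have rB := ring_lie_right_sub (x := Λ₁.op₁ N) (y := Λ₂.op₂ N) hzv hvz
  rw [hLM, hzero', mul_zero, add_zero] at rA
  rw [hLM, hzero', zero_mul, add_zero] at rB
  have hmix := ring_mixed_terms (At := star (u t) * du t) (Bt := dv t * star (v t)) rA rB
  have htr := hsum.trace_eq_zero t ht
  have hs := hsum.isLocal.trace_sub hF'.isLocal ht
  have hd := ring_conjugation (z := star (v t)) hmix hvz
  rw [htr, zero_sub, ← hd, ← density_mul hu hv, ← hv.density_eq_right] at hs
  have hsub := cuv.isLocal.trace_sub (cu.add cv).isLocal ht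
  rw [cu.isLocal.trace_add cv.isLocal ht] at hsub
  exact neg_eq_iff_eq_neg.2 (hsub.symm.trans hs)

end IsSmoothFamily

/-! ### Locality of propagators -/

/-- Grönwall's inequality for functions differentiable off a countable set. -/
theorem norm_le_exp_mul_of_hasDerivAt_off_countable {E : Type*} [NormedAddCommGroup E]
    [InnerProductSpace ℂ E] {D : Set ℝ} (hD : D.Countable) {T M : ℝ} (hT : 0 ≤ T)
    {φ φ' : ℝ → E} (hφ : Continuous φ) (hφ' : ∀ t ∉ D, ContinuousAt φ' t)
    (hd : ∀ t ∉ D, HasDerivAt φ (φ' t) t) (hM : ∀ t ∈ Icc 0 T, ‖φ' t‖ ≤ M * ‖φ t‖) :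
    ‖φ T‖ ≤ Real.exp (M * T) * ‖φ 0‖ := by
  -- Squaring the norm keeps the function differentiable at zeros of `φ`; the claim is that `exp (-2
  -- * M * t) * ‖φ t‖ ^ 2` does not increase.
  set k : ℝ → ℝ := fun t => Real.exp (-(2 * M) * t) * Complex.re (inner ℂ (φ t) (φ t)) with hk
  set k' : ℝ → ℝ := fun t => (Real.exp (-(2 * M) * t) * (-(2 * M) * 1)) *
      Complex.re (inner ℂ (φ t) (φ t)) +
    Real.exp (-(2 * M) * t) * Complex.re (inner ℂ (φ t) (φ' t) + inner ℂ (φ' t) (φ t)) with hk'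
  have hkd : ∀ t ∉ D, HasDerivAt k (k' t) t := fun t ht => by
    have h1 : HasDerivAt (fun t => Real.exp (-(2 * M) * t))
        (Real.exp (-(2 * M) * t) * (-(2 * M) * 1)) t :=
      ((hasDerivAt_id t).const_mul (-(2 * M))).exp
    have h2 := Complex.reCLM.hasFDerivAt.comp_hasDerivAt t ((hd t ht).inner ℂ (hd t ht))
    exact h1.mul h2
  have hkc : Continuous k := by
    have : Continuous fun t => Complex.re (inner ℂ (φ t) (φ t)) :=
      Complex.continuous_re.comp (hφ.inner hφ)
    fun_prop
  have hn : ∀ t, Complex.re (inner ℂ (φ t) (φ t)) = ‖φ t‖ ^ 2 := fun t =>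
    inner_self_eq_norm_sq (𝕜 := ℂ) (φ t)
  have hre : ∀ t ∈ Icc 0 T,
      |Complex.re (inner ℂ (φ t) (φ' t) + inner ℂ (φ' t) (φ t))| ≤ 2 * M * ‖φ t‖ ^ 2 := by
    intro t ht
    refine (Complex.abs_re_le_norm _).trans ((norm_add_le _ _).trans ?_)
    have h1 : ‖(inner ℂ (φ t) (φ' t) : ℂ)‖ ≤ ‖φ t‖ * ‖φ' t‖ := norm_inner_le_norm _ _
    have h2 : ‖(inner ℂ (φ' t) (φ t) : ℂ)‖ ≤ ‖φ' t‖ * ‖φ t‖ := norm_inner_le_norm _ _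
    nlinarith [mul_le_mul_of_nonneg_left (hM t ht) (norm_nonneg (φ t))]
  have hk'0 : ∀ t ∈ Icc 0 T, k' t ≤ 0 := fun t ht => by
    have h1 := (abs_le.1 (hre t ht)).2
    have h2 : k' t = Real.exp (-(2 * M) * t) *
        (Complex.re (inner ℂ (φ t) (φ' t) + inner ℂ (φ' t) (φ t)) - 2 * M * ‖φ t‖ ^ 2) := by
      rw [hk']; simp only [hn]; ring
    rw [h2]
    exact mul_nonpos_of_nonneg_of_nonpos (Real.exp_pos _).le (by linarith)
  have hk'm : AEStronglyMeasurable k' volume := by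
    refine aestronglyMeasurable_of_continuousAt_off_countable hD fun t ht => ?_
    have h1 := hφ.continuousAt (x := t)
    have h2 := hφ' t ht
    have h3 : ContinuousAt (fun t => Complex.re (inner ℂ (φ t) (φ t))) t :=
      Complex.continuous_re.continuousAt.comp (Tendsto.inner h1 h1)
    have h4 : ContinuousAt (fun t => Complex.re (inner ℂ (φ t) (φ' t) + inner ℂ (φ' t) (φ t))) t :=
      Complex.continuous_re.continuousAt.comp ((Tendsto.inner h1 h2).add (Tendsto.inner h2 h1))
    have h5 : ContinuousAt (fun t => Real.exp (-(2 * M) * t)) t := by fun_prop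
    exact ((h5.mul continuousAt_const).mul h3).add (h5.mul h4)
  obtain ⟨B, hB⟩ := isCompact_Icc.exists_bound_of_continuousOn (s := Icc 0 T)
    (f := fun t => Real.exp (-(2 * M) * t) * (4 * M * ‖φ t‖ ^ 2)) (by fun_prop)
  have hint : IntervalIntegrable k' volume 0 T := by
    refine intervalIntegrable_of_bounded (M := B) hT hk'm fun t ht => le_trans ?_ (hB t ht)
    have h1 := (abs_le.1 (hre t ht)).1
    have h2 : k' t = Real.exp (-(2 * M) * t) *
        (Complex.re (inner ℂ (φ t) (φ' t) + inner ℂ (φ' t) (φ t)) - 2 * M * ‖φ t‖ ^ 2) := by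
      rw [hk']; simp only [hn]; ring
    rw [Real.norm_eq_abs, abs_of_nonpos (hk'0 t ht), h2]
    refine le_trans ?_ (le_abs_self _)
    rw [← mul_neg]
    exact mul_le_mul_of_nonneg_left (by linarith) (Real.exp_pos _).le
  have hftc := integral_eq_of_hasDerivAt_off_countable k k' hD hkc.continuousOn
    (fun t ht => hkd t ht.2) hint
  have hle : k T ≤ k 0 := by
    have : ∫ t in (0 : ℝ)..T, k' t ≤ 0 := by
      rw [← neg_nonneg, ← intervalIntegral.integral_neg]
      exact intervalIntegral.integral_nonneg hT fun t ht => neg_nonneg.2 (hk'0 t ht)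
    linarith
  simp only [hk, hn, mul_zero, Real.exp_zero, one_mul] at hle
  refine le_of_sq_le_sq ?_ (by positivity)
  have e : Real.exp (M * T) ^ 2 * Real.exp (-(2 * M) * T) = 1 := by
    rw [← Real.exp_nat_mul, ← Real.exp_add]
    simp only [Nat.cast_ofNat]
    rw [Real.exp_eq_one_iff]; ring
  calc ‖φ T‖ ^ 2 = Real.exp (M * T) ^ 2 * (Real.exp (-(2 * M) * T) * ‖φ T‖ ^ 2) := by
        rw [← mul_assoc, e, one_mul]
    _ ≤ Real.exp (M * T) ^ 2 * ‖φ 0‖ ^ 2 := by gcongr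
    _ = _ := by ring

theorem entry_mulOp_mul (f : ℤ × ℤ → ℝ) (C : ℝ) (hC : 0 ≤ C) (hf : ∀ n, |f n| ≤ C)
    (A : Op N) (p q : Site N) : entry (mulOp f C hC hf * A) p q = f p.1 * entry A p q := by
  simp [entry, inner_siteVec_mulOp]

theorem entry_mul_mulOp (f : ℤ × ℤ → ℝ) (C : ℝ) (hC : 0 ≤ C) (hf : ∀ n, |f n| ≤ C)
    (A : Op N) (p q : Site N) : entry (A * mulOp f C hC hf) p q = f q.1 * entry A p q := by
  rw [entry, mul_apply_eq_comp, mulOp_siteVec, map_smul, inner_smul_right, entry]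

theorem PiecewiseStronglyContinuous.exists_countable {E : Type*} [NormedAddCommGroup E]
    [NormedSpace ℂ E] {H : ℝ → (E →L[ℂ] E)} (h : PiecewiseStronglyContinuous H) :
    ∃ D : Set ℝ, D.Countable ∧ ∀ t ∉ D, StronglyContinuousAt H t := by
  obtain ⟨D, hD, hc, -⟩ := h
  refine ⟨D, ?_, hc⟩
  have : D ⊆ ⋃ n : ℕ, D ∩ Icc (-(n : ℝ)) n := fun t ht => by
    obtain ⟨n, hn⟩ := exists_nat_ge |t|
    exact mem_iUnion.2 ⟨n, ht, abs_le.1 hn⟩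
  exact (countable_iUnion fun n => (hD _ _).countable).mono this

variable {T : ℝ} {H : ℝ → Op N}

theorem IsBulkHamiltonian.isLocal_zero (hH : IsBulkHamiltonian T H) : IsLocal T 0 0 H := by
  obtain ⟨μ, C, hμ, hC, h⟩ := hH.isLocal
  refine ⟨μ, C, hμ, hC.le, fun t ht p q => (norm_entry_le_kernel _ p q).trans ?_⟩
  simpa [decayExponent] using h t ht p.1 q.1

theorem IsBulkHamiltonian.exists_bound (hH : IsBulkHamiltonian T H) (hT : 0 < T) :
    ∃ M, ∀ t, ‖H t‖ ≤ M := by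
  obtain ⟨ν, C, hν, hC, h⟩ := hH.isLocal_zero
  refine ⟨C * expSum N ν, fun t => ?_⟩
  obtain ⟨s, hs, e⟩ := Function.Periodic.exists_mem_Ico₀ (f := H) hH.periodic hT t
  rw [e]
  refine opNorm_le_of_entry_le hν hC fun p q => ?_
  simpa [decayExponent] using h s (Ico_subset_Icc_self hs) p q

/-- Conjugation by a truncated exponential weight keeps a local operator bounded, uniformly in the
truncation. -/
theorem opNorm_conj_weight_le {A : Op N} {C ν R : ℝ} (hν : 0 < ν) (hC : 0 ≤ C)
    (hA : ∀ p q : Site N, ‖entry A p q‖ ≤ C * Real.exp (-(2 * ν) * latticeDist p.1 q.1))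
    (n : ℤ × ℤ) (hR : 1 ≤ R) {w : ℤ × ℤ → ℝ}
    (hw : ∀ m, w m = min (Real.exp (ν * latticeDist m n)) R)
    {B B' : ℝ} (hB : 0 ≤ B) (hB' : 0 ≤ B') (hwB : ∀ m, |w m| ≤ B) (hwB' : ∀ m, |(w m)⁻¹| ≤ B') :
    ‖mulOp w B hB hwB * A * mulOp (fun m => (w m)⁻¹) B' hB' hwB'‖ ≤ C * expSum N ν := by
  refine opNorm_le_of_entry_le hν hC fun p q => ?_
  rw [entry_mul_mulOp, entry_mulOp_mul, norm_mul, norm_mul, Complex.norm_real, Complex.norm_real]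
  have hpos : ∀ m, 0 < w m := fun m => by
    rw [hw]; exact lt_min (Real.exp_pos _) (by linarith)
  rw [Real.norm_of_nonneg (hpos _).le, Real.norm_of_nonneg (inv_pos.2 (hpos _)).le]
  have h1 : w p.1 ≤ Real.exp (ν * latticeDist p.1 q.1) * w q.1 := by
    have h2 : 1 ≤ Real.exp (ν * latticeDist p.1 q.1) :=
      Real.one_le_exp (mul_nonneg hν.le (latticeDist_nonneg _ _))
    -- The triangle inequality bounds the ratio of the weights at two sites by an exponential of
    -- their distance, and truncation at `R` preserves this since the exponential is at least one.
    -- Half of the decay rate `2 * ν` survives.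
    rw [hw, hw, mul_min_of_nonneg _ _ (Real.exp_pos _).le, ← Real.exp_add, ← mul_add]
    refine min_le_min (Real.exp_le_exp.2 ?_) (le_mul_of_one_le_left (by linarith) h2)
    exact mul_le_mul_of_nonneg_left (latticeDist_triangle _ _ _) hν.le
  have h3 : (w q.1)⁻¹ * w p.1 ≤ Real.exp (ν * latticeDist p.1 q.1) := by
    rw [inv_mul_le_iff₀ (hpos _), mul_comm]; exact h1
  rw [← mul_assoc]
  refine (mul_le_mul h3 (hA p q) (norm_nonneg _) (Real.exp_pos _).le).trans (le_of_eq ?_)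
  rw [mul_left_comm, ← Real.exp_add]
  ring_nf

/-- Taking adjoints is not strongly continuous in general; here it reverses time, so strong
continuity of the adjoint family comes from joint continuity of the propagator. -/
theorem IsPropagator.star_eq {U : ℝ → ℝ → Op N} (hU : IsPropagator H U) (t s : ℝ) :
    star (U t s) = U s t := by
  have h1 : U s t * U t s = 1 := by rw [hU.trans, hU.refl]
  have h2 := (Unitary.mem_iff.1 (hU.mem_unitary t s)).2
  rw [← one_mul (star (U t s)), ← h1, mul_assoc, h2, mul_one]

theorem norm_le_one_of_mem_unitary {A : Op N} (hA : A ∈ unitary (Op N)) : ‖A‖ ≤ 1 := by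
  have h := CStarRing.norm_star_mul_self (x := A)
  rw [(Unitary.mem_iff.1 hA).1] at h
  have h1 : ‖(1 : Op N)‖ ≤ 1 := ContinuousLinearMap.norm_id_le
  nlinarith [norm_nonneg A]

set_option maxHeartbeats 400000 in
/-- The propagator of a local Hamiltonian is local. -/
theorem IsPropagator.isLocal_zero {U : ℝ → ℝ → Op N} (hU : IsPropagator H U) {D : Set ℝ}
    (hD : D.Countable) (hc : ∀ t ∉ D, StronglyContinuousAt H t) {M : ℝ} (hM : ∀ t, ‖H t‖ ≤ M)
    (hH : IsLocal T 0 0 H) : IsLocal T 0 0 (fun t => U t 0) := by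
  obtain ⟨μ, C, hμ, hC, hloc⟩ := hH
  set ν := μ / 2 with hν
  have hν0 : 0 < ν := half_pos hμ
  have hS := expSum_nonneg (N := N) ν
  refine ⟨ν, Real.exp (C * expSum N ν * T), hν0, (Real.exp_pos _).le, fun t ht p q => ?_⟩
  -- The truncation is just the value of the weight at the target site `p`: the weight stays
  -- bounded, yet equals `R` at `p` and `1` at the source `q`. The Grönwall bound on the weighted
  -- norm is independent of `R`, so it yields the factor `R⁻¹` for the entry.
  set R := Real.exp (ν * latticeDist p.1 q.1) with hR
  have hR1 : 1 ≤ R := Real.one_le_exp (mul_nonneg hν0.le (latticeDist_nonneg _ _))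
  set w : ℤ × ℤ → ℝ := fun m => min (Real.exp (ν * latticeDist m q.1)) R with hw
  have hw1 : ∀ m, 1 ≤ w m := fun m =>
    le_min (Real.one_le_exp (mul_nonneg hν0.le (latticeDist_nonneg _ _))) hR1
  have hwB : ∀ m, |w m| ≤ R := fun m => by
    rw [abs_of_nonneg (by linarith [hw1 m])]; exact min_le_right _ _
  have hwB' : ∀ m, |(w m)⁻¹| ≤ 1 := fun m => by
    rw [abs_of_nonneg (inv_nonneg.2 (by linarith [hw1 m]))]; exact inv_le_one_of_one_le₀ (hw1 m)
  set W : Op N := mulOp w R (by linarith) hwB with hW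
  set W' : Op N := mulOp (fun m => (w m)⁻¹) 1 zero_le_one hwB' with hW'
  have hWW : ∀ ψ : HB N, W' (W ψ) = ψ := fun ψ => by
    refine ext_inner_siteVec fun x => ?_
    rw [hW', hW, inner_siteVec_mulOp, inner_siteVec_mulOp, ← mul_assoc, ← Complex.ofReal_mul,
      inv_mul_cancel₀ (by linarith [hw1 x.1]), Complex.ofReal_one, one_mul]
  set φ : ℝ → HB N := fun s => W (U s 0 (siteVec q)) with hφ
  set φ' : ℝ → HB N := fun s => W (-Complex.I • H s (U s 0 (siteVec q))) with hφ'
  have hUc : Continuous fun s => U s 0 (siteVec q) :=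
    (hU.continuous (siteVec q)).comp (continuous_id.prodMk continuous_const)
  have hbound : ∀ s ∈ Icc 0 t, ‖φ' s‖ ≤ C * expSum N ν * ‖φ s‖ := fun s hs => by
    have e : φ' s = -Complex.I • (W * H s * W') (φ s) := by
      simp only [hφ', hφ, mul_apply_eq_comp, hWW, map_smul]
    rw [e, norm_smul, norm_neg, Complex.norm_I, one_mul]
    refine ContinuousLinearMap.le_of_opNorm_le _ ?_ _
    refine opNorm_conj_weight_le hν0 hC (fun x y => ?_) q.1 hR1 (fun _ => rfl) _ _ _ _
    have := hloc s ⟨hs.1, hs.2.trans ht.2⟩ x y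
    rw [hν, mul_div_cancel₀ μ two_ne_zero]
    simpa [decayExponent] using this
  have hgron := norm_le_exp_mul_of_hasDerivAt_off_countable hD ht.1 (φ := φ) (φ' := φ')
    (W.continuous.comp hUc)
    (fun s hs => W.continuous.continuousAt.comp ((tendsto_apply_of_bounded (Z := H) hM
      (hc s hs _) hUc.continuousAt).const_smul (-Complex.I)))
    (fun s hs => (W.restrictScalars ℝ).hasFDerivAt.comp_hasDerivAt s (hU.schrodinger s 0 (hc s hs) (siteVec q))) hbound
  have h0 : ‖φ 0‖ = 1 := by
    have e : w q.1 = 1 := by simp [hw, latticeDist_self, hR1]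
    simp only [hφ, hU.refl, one_apply_eq_self]
    rw [hW, mulOp_siteVec, e, Complex.ofReal_one, one_smul, norm_siteVec]
  have h1 : R * ‖entry (U t 0) p q‖ ≤ ‖φ t‖ := by
    have e : w p.1 = R := by simp [hw, hR]
    have := norm_inner_le_norm (𝕜 := ℂ) (siteVec p) (φ t)
    rw [norm_siteVec, one_mul] at this
    simp only [hφ] at this
    rw [hW, inner_siteVec_mulOp, norm_mul, Complex.norm_real, e,
      Real.norm_of_nonneg (by linarith)] at this
    exact this
  have h2 : Real.exp (C * expSum N ν * t) ≤ Real.exp (C * expSum N ν * T) := by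
    gcongr; exact ht.2
  rw [h0, mul_one] at hgron
  have h3 : Real.exp (-ν * decayExponent 0 0 p.1 q.1) = R⁻¹ := by
    rw [hR, ← Real.exp_neg]; simp [decayExponent]
  rw [h3, ← div_eq_mul_inv, le_div_iff₀ (by linarith), mul_comm]
  exact h1.trans (hgron.trans h2)

theorem IsPropagator.isSmoothFamily {U : ℝ → ℝ → Op N} (hU : IsPropagator H U)
    (hH : IsBulkHamiltonian T H) (hT : 0 < T) {D : Set ℝ} (hD : D.Countable)
    (hc : ∀ t ∉ D, StronglyContinuousAt H t) :
    IsSmoothFamily D T (fun t => U t 0) (fun t => -Complex.I • (H t * U t 0)) := by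
  obtain ⟨M, hM⟩ := hH.exists_bound hT
  have hloc := hU.isLocal_zero hD hc hM hH.isLocal_zero
  have hu : IsConfined ∅ T 0 0 (fun t => U t 0) :=
    ⟨⟨1, fun t => norm_le_one_of_mem_unitary (hU.mem_unitary t 0)⟩,
      fun t _ ψ => ((hU.continuous ψ).comp
        (continuous_id.prodMk continuous_const)).continuousAt, hloc⟩
  refine ⟨fun t => hU.mem_unitary t 0, hu, ⟨?_, ?_, hloc.star⟩, ?_, ?_⟩
  · obtain ⟨B, hB⟩ := hu.bounded
    exact ⟨B, fun t => (norm_star (U t 0)).le.trans (hB t)⟩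
  · intro t _ ψ
    simp only [hU.star_eq]
    exact ((hU.continuous ψ).comp (continuous_const.prodMk continuous_id)).continuousAt
  · exact ((IsConfined.mk ⟨M, hM⟩ hc hH.isLocal_zero).mul hu.of_empty).smul _
  · exact fun t ht ψ => hU.schrodinger t 0 (hc t ht) ψ

end

end BulkIndex

/-! ### Additivity for propagators of bulk Hamiltonians -/

theorem mainTheorem9 (N : ℕ) (T : ℝ) (hT : 0 < T)
    (H K : ℝ → BulkIndex.Op N)
    (hH : BulkIndex.IsBulkHamiltonian T H) (hK : BulkIndex.IsBulkHamiltonian T K)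
    (U V : ℝ → ℝ → BulkIndex.Op N)
    (hU : BulkIndex.IsPropagator H U) (hV : BulkIndex.IsPropagator K V)
    (hUT : U T 0 = 1) (hVT : V T 0 = 1) :
    ∃ a b : ℂ,
      BulkIndex.HasBulkIndex T (fun t => U t 0) a ∧
      BulkIndex.HasBulkIndex T (fun t => V t 0) b ∧
      BulkIndex.HasBulkIndex T (fun t => U t 0 * V t 0) (a + b) := by
  obtain ⟨D, hD, hc⟩ := hH.piecewise.exists_countable
  obtain ⟨D', hD', hc'⟩ := hK.piecewise.exists_countable
  have hDD := hD.union hD'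
  have hu := hU.isSmoothFamily hH hT hDD fun t ht => hc t fun h => ht (Or.inl h)
  have hv := hV.isSmoothFamily hK hT hDD fun t ht => hc' t fun h => ht (Or.inr h)
  have hua := hu.indexIntegral_congr hDD hT.le (hU.refl 0) hUT
  have hva := hv.indexIntegral_congr hDD hT.le (hV.refl 0) hVT
  -- The values are computed with the step functions. For the product no separate independence
  -- argument is needed: additivity holds for each pair of switches, and the right side does not
  -- depend on the pair.
  refine ⟨_, _, hu.hasBulkIndex hDD hT.le fun Λ₁ Λ₂ => hua Λ₁ Λ₂ .step .step,
    hv.hasBulkIndex hDD hT.le fun Λ₁ Λ₂ => hva Λ₁ Λ₂ .step .step,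
    (hu.mul hv).hasBulkIndex hDD hT.le fun Λ₁ Λ₂ => ?_⟩
  rw [← hua Λ₁ Λ₂, ← hva Λ₁ Λ₂, (hu.mul hv).indexIntegral_eq hDD, hu.indexIntegral_eq hDD,
    hv.indexIntegral_eq hDD, hu.integral_density_mul hv hDD hT.le (hU.refl 0) hUT (hV.refl 0) hVT,
    mul_add]
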